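/- Let $n\ge 1$ and let $\mathcal O_{\mathbb C^n,0}$ be the ring of germs at $0$ of holomorphic functions on $\mathbb C^n$, with maximal ideal $\mathbf m$. A polynomial $f\in\mathbb C[x_1,\dots,x_n]$ is quasihomogeneous if there are real numbers $w_1,\dots,w_n,d>0$ such that $\sum_i\alpha_iw_i=d$ for every monomial $x^\alpha$ occurring in $f$. A quasihomogeneous $f$ has an isolated singularity at $0$ if the partial derivatives $\partial f/\partial x_1,\dots,\partial f/\partial x_n$ vanish simultaneously precisely at $0\in\mathbb C^n$; its Milnor number is $\dim_{\mathbb C}\mathcal O_{\mathbb C^n,0}/\left(\frac{\partial f}{\partial x_1},\dots,\frac{\partial f}{\partial x_n}\right)$. A natural number $\mu>2^n$ is called an $n$-gap if there is no quasihomogeneous polynomial $f\in\mathbb C[x_1,\dots,x_n]$ with $f\in\mathbf m^3$, with an isolated singularity at $0$ and with Milnor number $\mu$. **Corollary 6.3.** For every $n\ge 3$ the set of $n$-gaps contains the set $$\{2p+(-1)^n \mid p \text{ and } 2p+(-1)^n \text{ are prime numbers},\ 2p+(-1)^n>2^n\}.$$ -/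

import Mathlib

open scoped BigOperators

namespace QHSing

/-- A formal power series `φ = ∑ a_α x^α` in `n` variables is convergent if it converges
absolutely on some polydisc of positive radius around the origin. -/
def IsConvergent {n : ℕ} (φ : MvPowerSeries (Fin n) ℂ) : Prop :=
  ∃ r : ℝ, 0 < r ∧
    Summable (fun α : Fin n →₀ ℕ => ‖MvPowerSeries.coeff α φ‖ * r ^ Finsupp.degree α)

theorem IsConvergent.mono_radius {n : ℕ} {φ : MvPowerSeries (Fin n) ℂ} {r s : ℝ}
    (hr : 0 < r) (hrs : r ≤ s)
    (h : Summable (fun α : Fin n →₀ ℕ => ‖MvPowerSeries.coeff α φ‖ * s ^ Finsupp.degree α)) :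
    Summable (fun α : Fin n →₀ ℕ => ‖MvPowerSeries.coeff α φ‖ * r ^ Finsupp.degree α) := by
  refine Summable.of_nonneg_of_le (fun α => by positivity) (fun α => ?_) h
  gcongr

theorem IsConvergent.add {n : ℕ} {φ ψ : MvPowerSeries (Fin n) ℂ}
    (hφ : IsConvergent φ) (hψ : IsConvergent ψ) : IsConvergent (φ + ψ) := by
  obtain ⟨r, hr, h1⟩ := hφ
  obtain ⟨s, hs, h2⟩ := hψ
  refine ⟨min r s, lt_min hr hs, ?_⟩
  have h1' := IsConvergent.mono_radius (lt_min hr hs) (min_le_left r s) h1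
  have h2' := IsConvergent.mono_radius (lt_min hr hs) (min_le_right r s) h2
  have ht : 0 < min r s := lt_min hr hs
  refine Summable.of_nonneg_of_le (fun α => by positivity) (fun α => ?_) (h1'.add h2')
  rw [map_add, ← add_mul]
  gcongr
  exact norm_add_le _ _

theorem IsConvergent.mul {n : ℕ} {φ ψ : MvPowerSeries (Fin n) ℂ}
    (hφ : IsConvergent φ) (hψ : IsConvergent ψ) : IsConvergent (φ * ψ) := by
  classical
  obtain ⟨r, hr, h1⟩ := hφ
  obtain ⟨s, hs, h2⟩ := hψ
  have ht : 0 < min r s := lt_min hr hs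
  refine ⟨min r s, ht, ?_⟩
  have h1' := IsConvergent.mono_radius ht (min_le_left r s) h1
  have h2' := IsConvergent.mono_radius ht (min_le_right r s) h2
  have h3 : Summable fun α : Fin n →₀ ℕ => ∑ p ∈ Finset.HasAntidiagonal.antidiagonal α,
      (‖MvPowerSeries.coeff p.1 φ‖ * min r s ^ Finsupp.degree p.1) *
        (‖MvPowerSeries.coeff p.2 ψ‖ * min r s ^ Finsupp.degree p.2) :=
    summable_sum_mul_antidiagonal_of_summable_mul
      (f := fun α : Fin n →₀ ℕ => ‖MvPowerSeries.coeff α φ‖ * min r s ^ Finsupp.degree α)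
      (g := fun α : Fin n →₀ ℕ => ‖MvPowerSeries.coeff α ψ‖ * min r s ^ Finsupp.degree α)
      (h1'.mul_of_nonneg h2' (fun α => by positivity) (fun α => by positivity))
  refine Summable.of_nonneg_of_le (fun α => by positivity) (fun α => ?_) h3
  have h4 : ‖MvPowerSeries.coeff α (φ * ψ)‖ ≤ ∑ p ∈ Finset.HasAntidiagonal.antidiagonal α,
      ‖MvPowerSeries.coeff p.1 φ‖ * ‖MvPowerSeries.coeff p.2 ψ‖ := by
    rw [MvPowerSeries.coeff_mul]
    refine (norm_sum_le _ _).trans (le_of_eq (Finset.sum_congr rfl fun p _ => norm_mul _ _))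
  refine (mul_le_mul_of_nonneg_right h4 (pow_nonneg ht.le _)).trans (le_of_eq ?_)
  rw [Finset.sum_mul]
  refine Finset.sum_congr rfl (fun p hp => ?_)
  have h5 : Finsupp.degree α = Finsupp.degree p.1 + Finsupp.degree p.2 := by
    rw [← Finset.HasAntidiagonal.mem_antidiagonal.mp hp, map_add]
  rw [h5, pow_add]
  ring

theorem isConvergent_coe {n : ℕ} (f : MvPolynomial (Fin n) ℂ) :
    IsConvergent (f : MvPowerSeries (Fin n) ℂ) := by
  refine ⟨1, one_pos, summable_of_ne_finset_zero (s := f.support) (fun α hα => ?_)⟩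
  rw [MvPolynomial.notMem_support_iff] at hα
  simp [MvPolynomial.coeff_coe, hα]

/-- The local ring `𝒪_{ℂⁿ,0} = ℂ{x₁, …, xₙ}` of germs at the origin of holomorphic functions,
as the `ℂ`-algebra of convergent power series. -/
noncomputable def germRing (n : ℕ) : Subalgebra ℂ (MvPowerSeries (Fin n) ℂ) where
  carrier := {φ | IsConvergent φ}
  mul_mem' := IsConvergent.mul
  add_mem' := IsConvergent.add
  algebraMap_mem' c := by
    have h := isConvergent_coe (n := n) (MvPolynomial.C c)
    rwa [MvPolynomial.coe_C] at h

/-- The germ at the origin of a polynomial function. -/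
noncomputable def germ {n : ℕ} (f : MvPolynomial (Fin n) ℂ) : germRing n :=
  ⟨(f : MvPowerSeries (Fin n) ℂ), isConvergent_coe f⟩

/-- The maximal ideal `𝐦` of `𝒪_{ℂⁿ,0}`: the germs which vanish at the origin. -/
noncomputable def maxIdeal (n : ℕ) : Ideal (germRing n) :=
  RingHom.ker ((MvPowerSeries.constantCoeff (σ := Fin n) (R := ℂ)).comp
    (germRing n).val.toRingHom)

/-- The Jacobian ideal `J_f = (∂f/∂x₁, …, ∂f/∂xₙ) ⊆ 𝒪_{ℂⁿ,0}`. -/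
noncomputable def jacobianIdeal {n : ℕ} (f : MvPolynomial (Fin n) ℂ) : Ideal (germRing n) :=
  Ideal.span (Set.range fun i : Fin n => germ (MvPolynomial.pderiv i f))

/-- The Milnor number `μ(f) = dim_ℂ 𝒪_{ℂⁿ,0} / J_f` (the value is `0` if this dimension is
infinite). -/
noncomputable def milnorNumber {n : ℕ} (f : MvPolynomial (Fin n) ℂ) : ℕ :=
  Module.finrank ℂ (germRing n ⧸ jacobianIdeal f)

/-- `f` is quasihomogeneous: there are positive real weights `w₁, …, wₙ` and a positive weighted
degree `d` such that every monomial `x^α` of `f` satisfies `∑ αᵢ wᵢ = d`. -/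
def IsQuasihomogeneous {n : ℕ} (f : MvPolynomial (Fin n) ℂ) : Prop :=
  ∃ (w : Fin n → ℝ) (d : ℝ), (∀ i, 0 < w i) ∧ 0 < d ∧
    ∀ α ∈ f.support, ∑ i, (α i : ℝ) * w i = d

/-- `f` has an isolated singularity at `0`, in the sense used for quasihomogeneous polynomials:
the partial derivatives of `f` vanish simultaneously precisely at the origin of `ℂⁿ`. -/
def HasIsolatedSingularity {n : ℕ} (f : MvPolynomial (Fin n) ℂ) : Prop :=
  ∀ x : Fin n → ℂ, (∀ i, MvPolynomial.eval x (MvPolynomial.pderiv i f) = 0) ↔ x = 0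

/-- `μ` is an `n`-gap: `μ > 2ⁿ`, and no quasihomogeneous polynomial `f ∈ 𝐦³` in `n` variables
with an isolated singularity at `0` has Milnor number `μ`. -/
def IsGap (n μ : ℕ) : Prop :=
  2 ^ n < μ ∧
    ¬ ∃ f : MvPolynomial (Fin n) ℂ, IsQuasihomogeneous f ∧ germ f ∈ maxIdeal n ^ 3 ∧
      HasIsolatedSingularity f ∧ milnorNumber f = μ

end QHSing

/-! Scale the weights so that `f` has weighted degree 1. Since the gradient vanishes only at 0,
every `i` admits a monomial `xᵢ^{aᵢ} x_{κ i}` in `f`, and `f ∈ 𝐦³` forces `aᵢ ≥ 2`. The relations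
`aᵢ wᵢ = 1 - w_{κ i}` make the weights rational and smaller than 1/2, and the Milnor–Orlik formula
reads `μ = ∏ (1 - wᵢ) / wᵢ` (`exists_weights`).

Arithmetic. Write `wᵢ = sᵢ / tᵢ` in lowest terms. From `μ ∏ sᵢ = ∏ (tᵢ - sᵢ)` a prime `μ` divides
some `tᵢ - sᵢ`, so `tᵢ - sᵢ` is at least the whole product of ratios. That is impossible if `i` lies
on a `κ`-cycle of length at least two (`lt_prod_of_cycle`); otherwise, if `κ i ≠ i`, the same bound
passes to `κ i` and the remaining indices. Hence the indices form one chain ending at a fixed point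
(`exists_chain`), and unwinding it gives `μ = bM + (-1)ⁿ` with `b, M ≥ 3` once `n ≥ 3`. So `μ -
(-1)ⁿ` is not twice a prime (`prime_ne_of_weights`).

Milnor–Orlik formula. With integer weights `Wᵢ` and degree `D`, the partial derivatives are
homogeneous of degrees `D - Wᵢ` and, by the Nullstellensatz, generate an ideal containing all
monomials of large degree. Comparison with the variables in the local ring at 0 shows that they form
a regular sequence (`isWeaklyRegular_of_maximalIdeal_le_radical`,
`isWeaklyRegular_of_localization`). A Hilbert series count then gives the codimension
(`finrank_quotient_mul_prod`), and passing to germs does not change it (`finrank_germ_quotient`). -/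

namespace QHSing

/-! ### Arithmetic of the weights -/

section Arithmetic

variable {ι : Type*} {w : ι → ℚ} {a : ι → ℕ} {κ : ι → ι}

theorem den_dvd_of_mul_eq_int {m I : ℤ} {q : ℚ} (h : (m : ℚ) * q = I) : (q.den : ℤ) ∣ m := by
  have h1 : m * q.num = I * q.den := by
    have h2 : (q.num : ℚ) = q * q.den := (Rat.mul_den_eq_num q).symm
    have : ((m * q.num : ℤ) : ℚ) = ((I * q.den : ℤ) : ℚ) := by
      push_cast
      rw [h2, ← mul_assoc, h]
    exact_mod_cast this
  have hc : IsCoprime (q.den : ℤ) q.num := by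
    have := q.reduced
    rw [Int.isCoprime_iff_nat_coprime]
    simpa using this.symm
  exact hc.dvd_of_dvd_mul_right ⟨I, by rw [h1]; ring⟩

/-- Because `2 wᵢ ≤ aᵢ wᵢ = 1 - w_{κ i} < 1`. Consequently every factor `(1 - w) / w` exceeds 1, so
products of ratios grow with the index set. -/
theorem weight_lt_half (hw : ∀ i, 0 < w i) (ha : ∀ i, 2 ≤ a i)
    (h : ∀ i, (a i : ℚ) * w i = 1 - w (κ i)) (i : ι) : w i < 1 / 2 := by
  have h1 := h i
  have h2 := hw (κ i)
  have h3 : (2 : ℚ) * w i ≤ a i * w i :=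
    mul_le_mul_of_nonneg_right (by exact_mod_cast ha i) (hw i).le
  linarith

theorem one_lt_ratio {q : ℚ} (h0 : 0 < q) (h1 : q < 1 / 2) : 1 < (1 - q) / q := by
  rw [lt_div_iff₀ h0]
  linarith

theorem ratio_eq {q : ℚ} (h0 : 0 < q) : (1 - q) / q = ((q.den : ℚ) - q.num) / q.num := by
  have hd : (q.den : ℚ) ≠ 0 := by exact_mod_cast q.den_nz
  have hn : (q.num : ℚ) ≠ 0 := by
    have := Rat.num_pos.mpr h0
    exact_mod_cast this.ne'
  have h2 : (q.num : ℚ) = q * q.den := (Rat.mul_den_eq_num q).symm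
  rw [div_eq_div_iff h0.ne' hn, h2]
  ring

/-- Telescoping the relations along the orbit. When the orbit closes up after `c` steps, `(∏ a -
(-1)^c) wᵢ` is an integer, which bounds the denominator of `wᵢ`. -/
theorem iterate_weight (h : ∀ i, (a i : ℚ) * w i = 1 - w (κ i)) (i : ι) (k : ℕ) :
    ∃ I : ℤ, (∏ j ∈ Finset.range k, (a (κ^[j] i) : ℚ)) * w i = I + (-1) ^ k * w (κ^[k] i) := by
  induction k with
  | zero => exact ⟨0, by simp⟩
  | succ k ih =>
    obtain ⟨I, hI⟩ := ih
    refine ⟨a (κ^[k] i) * I + (-1) ^ k, ?_⟩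
    have h1 := h (κ^[k] i)
    rw [Finset.prod_range_succ, mul_right_comm, hI, Function.iterate_succ_apply']
    push_cast
    rw [pow_succ]
    linear_combination (-1) ^ k * h1

/-- On a `κ`-cycle the product of the ratios `(1 - w) / w` is the product of the exponents. -/
theorem prod_cycle (hw : ∀ i, 0 < w i) (h : ∀ i, (a i : ℚ) * w i = 1 - w (κ i)) {i : ι} {c : ℕ}
    (hc : κ^[c] i = i) :
    ∏ j ∈ Finset.range c, (1 - w (κ^[j] i)) / w (κ^[j] i) =
      ∏ j ∈ Finset.range c, (a (κ^[j] i) : ℚ) := by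
  have h1 : ∏ j ∈ Finset.range c, (1 - w (κ^[j] i)) =
      ∏ j ∈ Finset.range c, (1 - w (κ^[j + 1] i)) := by
    have h2 := Finset.prod_range_succ (fun j => 1 - w (κ^[j] i)) c
    have h3 := Finset.prod_range_succ' (fun j => 1 - w (κ^[j] i)) c
    rw [h2] at h3
    simp only [hc, Function.iterate_zero, id_eq] at h3
    -- The cyclic shift of the numerators comes from cancelling `1 - w i` between two expansions of
    -- one product; if that factor vanishes, both sides are zero.
    by_cases h4 : 1 - w i = 0
    · rcases c with _ | c
      · simp
      · have e1 : ∏ j ∈ Finset.range (c + 1), (1 - w (κ^[j] i)) = 0 :=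
          Finset.prod_eq_zero (i := 0) (by simp) (by simpa using h4)
        have e2 : ∏ j ∈ Finset.range (c + 1), (1 - w (κ^[j + 1] i)) = 0 :=
          Finset.prod_eq_zero (i := c) (by simp) (by rw [hc]; exact h4)
        rw [e1, e2]
    · exact mul_right_cancel₀ h4 h3
  have h5 : ∏ j ∈ Finset.range c, w (κ^[j] i) ≠ 0 :=
    Finset.prod_ne_zero_iff.mpr fun j _ => (hw _).ne'
  rw [Finset.prod_div_distrib, div_eq_iff h5, ← Finset.prod_mul_distrib, h1]
  refine Finset.prod_congr rfl fun j _ => ?_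
  rw [Function.iterate_succ_apply', h]

variable [DecidableEq ι]

theorem prod_ratio_mono (hw : ∀ i, 0 < w i) (hw2 : ∀ i, w i < 1 / 2) {U V : Finset ι}
    (hUV : U ⊆ V) : ∏ i ∈ U, (1 - w i) / w i ≤ ∏ i ∈ V, (1 - w i) / w i := by
  rw [← Finset.prod_sdiff hUV]
  refine le_mul_of_one_le_left (Finset.prod_nonneg fun i _ =>
    (zero_lt_one.trans (one_lt_ratio (hw i) (hw2 i))).le) ?_
  exact Finset.prod_induction (fun i => (1 - w i) / w i) (fun q : ℚ => 1 ≤ q)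
    (fun _ _ => one_le_mul_of_one_le_of_one_le) le_rfl
    (fun i _ => (one_lt_ratio (hw i) (hw2 i)).le)

/-- A set of indices which contains a `κ`-cycle of length at least two through `i` has a product
of ratios exceeding `t - s`, where `w i = s / t`. -/
theorem lt_prod_of_cycle (hw : ∀ i, 0 < w i) (ha : ∀ i, 2 ≤ a i)
    (h : ∀ i, (a i : ℚ) * w i = 1 - w (κ i)) {i : ι} {c : ℕ} (hc2 : 2 ≤ c) (hc : κ^[c] i = i)
    (hinj : Set.InjOn (fun j => κ^[j] i) (Set.Iio c)) {U : Finset ι} (hU : ∀ j, κ^[j] i ∈ U) :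
    ((w i).den : ℚ) - (w i).num < ∏ j ∈ U, (1 - w j) / w j := by
  have hw2 := weight_lt_half hw ha h
  set A : ℕ := ∏ j ∈ Finset.range c, a (κ^[j] i) with hA
  have hA2 : 2 ≤ A := by
    calc 2 ≤ a (κ^[0] i) := ha _
      _ ≤ A := Nat.le_of_dvd (Finset.prod_pos fun j _ => by linarith [ha (κ^[j] i)])
          (Finset.dvd_prod_of_mem _ (by simp; omega))
  have hprod : ∏ j ∈ Finset.range c, (1 - w (κ^[j] i)) / w (κ^[j] i) = A := by
    rw [prod_cycle hw h hc, hA]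
    push_cast
    rfl
  have hle : ∏ j ∈ Finset.range c, (1 - w (κ^[j] i)) / w (κ^[j] i) ≤
      ∏ j ∈ U, (1 - w j) / w j := by
    rw [← Finset.prod_image (f := fun j => (1 - w j) / w j) (g := fun j => κ^[j] i)
      (s := Finset.range c) (by simpa using hinj)]
    refine prod_ratio_mono hw hw2 fun j hj => ?_
    obtain ⟨k, _, rfl⟩ := Finset.mem_image.mp hj
    exact hU k
  -- The cycle has a second index, whose ratio is strictly greater than 1.
  have hratio : (1 - w i) / w i < A := by
    rw [← hprod]
    obtain ⟨d, rfl⟩ : ∃ d, c = d + 2 := ⟨c - 2, by omega⟩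
    rw [Finset.prod_range_succ', Finset.prod_range_succ']
    simp only [Function.iterate_zero, id_eq, zero_add]
    have hi := one_lt_ratio (hw i) (hw2 i)
    have h1 := one_lt_ratio (hw (κ^[1] i)) (hw2 (κ^[1] i))
    have h2 : 1 ≤ ∏ j ∈ Finset.range d, (1 - w (κ^[j + 1 + 1] i)) / w (κ^[j + 1 + 1] i) :=
      Finset.prod_induction (f := fun j => (1 - w (κ^[j + 1 + 1] i)) / w (κ^[j + 1 + 1] i))
        (fun q : ℚ => 1 ≤ q) (fun _ _ => one_le_mul_of_one_le_of_one_le) le_rfl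
        (fun j _ => (one_lt_ratio (hw _) (hw2 _)).le)
    have h3 := one_lt_mul_of_le_of_lt h2 h1
    exact lt_mul_of_one_lt_left (by linarith) h3
  have hden : ((w i).den : ℤ) ≤ A + 1 := by
    obtain ⟨I, hI⟩ := iterate_weight h i c
    rw [hc] at hI
    have h1 : ((w i).den : ℤ) ∣ A - (-1) ^ c := by
      refine den_dvd_of_mul_eq_int (I := I) ?_
      push_cast [hA]
      linear_combination hI
    -- Since `A ≥ 2`, both `A - 1` and `A + 1` are positive, so divisibility bounds the denominator.
    rcases neg_one_pow_eq_or ℤ c with h2 | h2 <;> rw [h2] at h1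
    · have := Int.le_of_dvd (by omega) h1
      omega
    · have := Int.le_of_dvd (by omega) h1
      omega
  refine lt_of_lt_of_le ?_ (hprod ▸ hle)
  have hs : 1 ≤ (w i).num := Rat.num_pos.mpr (hw i)
  -- If `s = 1`, then `t - s` is the ratio at `i`, already below `A`; if `s ≥ 2`, the bound `t ≤ A +
  -- 1` suffices.
  rcases hs.eq_or_lt with h1 | h1
  · rw [ratio_eq (hw i), ← h1, Int.cast_one, div_one] at hratio
    rwa [← h1, Int.cast_one]
  · have : ((w i).den : ℤ) - (w i).num < A := by omega
    exact_mod_cast this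

/-- If `w i = s / t` with `t - s` at least the product of all the ratios in `U`, then `U` is a
chain `i, κ i, κ² i, …` ending at a fixed point of `κ`, and this computes the product. -/
theorem exists_chain (hw : ∀ i, 0 < w i) (ha : ∀ i, 2 ≤ a i)
    (h : ∀ i, (a i : ℚ) * w i = 1 - w (κ i)) (U : Finset ι) (i : ι) (hU : ∀ j, κ^[j] i ∈ U)
    (hle : ∏ j ∈ U, (1 - w j) / w j ≤ (w i).den - (w i).num) :
    ∃ b P M : ℤ, 3 ≤ b ∧ ∏ j ∈ U, (1 - w j) / w j = b * P * (1 - w i) ∧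
      ∏ j ∈ U, (1 - w j) / w j = b * M + (-1) ^ U.card ∧ 1 ≤ M ∧ M ≤ P ∧
      (2 ≤ U.card → M < P) ∧ (3 ≤ U.card → 3 ≤ M) := by
  have hw2 := weight_lt_half hw ha h
  induction hk : U.card generalizing U i with
  | zero =>
    have := hU 0
    rw [Finset.card_eq_zero.mp hk] at this
    simp at this
  | succ k ih =>
    have hiU : i ∈ U := hU 0
    have hsplit := Finset.mul_prod_erase U (fun j => (1 - w j) / w j) hiU
    have hs : (0 : ℚ) < (w i).num := by exact_mod_cast Rat.num_pos.mpr (hw i)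
    have hr := one_lt_ratio (hw i) (hw2 i)
    have hts : (0 : ℚ) < (w i).den - (w i).num := by
      rw [ratio_eq (hw i), lt_div_iff₀ hs] at hr
      linarith
    -- The bound reads `(t - s) / s * rest ≤ t - s`; cancel `t - s`.
    have herase : ∏ j ∈ U.erase i, (1 - w j) / w j ≤ (w i).num := by
      rw [← hsplit, ratio_eq (hw i), div_mul_eq_mul_div, div_le_iff₀ hs] at hle
      exact le_of_mul_le_mul_left hle hts
    have hcard : (U.erase i).card = k := by rw [Finset.card_erase_of_mem hiU, hk]; rfl
    by_cases hfix : κ i = i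
    · have hi := h i
      rw [hfix] at hi
      have hwi : w i = 1 / ((a i + 1 : ℕ) : ℚ) := by
        rw [eq_div_iff (by positivity)]
        push_cast
        linarith
      have hnum : (w i).num = 1 := by
        rw [hwi, one_div]
        exact Rat.inv_natCast_num_of_pos (Nat.succ_pos _)
      -- Here `s = 1`, so the remaining ratios, each greater than 1, have product at most 1.
      have hempty : U.erase i = ∅ := by
        by_contra hne
        obtain ⟨j, hj⟩ := Finset.nonempty_iff_ne_empty.mpr hne
        have h1 := prod_ratio_mono hw hw2 (Finset.singleton_subset_iff.mpr hj)
        rw [Finset.prod_singleton] at h1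
        have h2 := one_lt_ratio (hw j) (hw2 j)
        rw [hnum] at herase
        push_cast at herase
        linarith
      have hk0 : k = 0 := by rw [← hcard, hempty]; rfl
      rw [hempty, Finset.prod_empty, mul_one] at hsplit
      have ha' : ((a i + 1 : ℕ) : ℚ) ≠ 0 := by positivity
      have hval : (1 - w i) / w i = a i := by
        rw [div_eq_iff (hw i).ne']
        linarith
      refine ⟨a i + 1, 1, 1, by have := ha i; omega, ?_, ?_, le_rfl, le_rfl, by omega, by omega⟩
      · rw [← hsplit, hval]
        push_cast
        linarith
      · rw [← hsplit, hval, hk0]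
        push_cast
        ring
    · have hnotper : ∀ j, κ^[j] (κ i) ≠ i := by
        intro j hj
        have hper : Function.IsPeriodicPt κ (j + 1) i := hj
        have hm := Function.iterate_minimalPeriod (f := κ) (x := i)
        have hpos := hper.minimalPeriod_pos (Nat.succ_pos j)
        have hne1 : Function.minimalPeriod κ i ≠ 1 := by
          intro h1
          rw [h1] at hm
          exact hfix hm
        refine absurd hle (not_le.mpr (lt_prod_of_cycle hw ha h (by omega) hm ?_ hU))
        exact Function.iterate_injOn_Iio_minimalPeriod
      have hi := h i
      -- Clearing denominators in the relation at `i` gives `aᵢ sᵢ t' = tᵢ (t' - s')` with `s' / t'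
      -- = w (κ i)`, and `sᵢ` is prime to `tᵢ`. Thus the bound by `sᵢ` becomes the induction
      -- hypothesis at `κ i`.
      have hdvd : (w i).num ∣ (w (κ i)).den - (w (κ i)).num := by
        have e1 : w i * (w i).den = (w i).num := Rat.mul_den_eq_num _
        have e2 : w (κ i) * (w (κ i)).den = (w (κ i)).num := Rat.mul_den_eq_num _
        have e3 : (a i : ℤ) * (w i).num * (w (κ i)).den =
            (w i).den * ((w (κ i)).den - (w (κ i)).num) := by
          have : (a i : ℚ) * (w i).num * (w (κ i)).den =
              (w i).den * ((w (κ i)).den - (w (κ i)).num) := by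
            rw [← e1, ← e2]
            linear_combination ((w i).den : ℚ) * (w (κ i)).den * hi
          exact_mod_cast this
        have hc : IsCoprime (w i).num ((w i).den : ℤ) := by
          rw [Int.isCoprime_iff_nat_coprime]
          simpa using (w i).reduced
        exact hc.dvd_of_dvd_mul_left ⟨a i * (w (κ i)).den, by rw [← e3]; ring⟩
      have hpos : (0 : ℤ) < (w (κ i)).den - (w (κ i)).num := by
        have h1 := one_lt_ratio (hw (κ i)) (hw2 (κ i))
        have h2 : (0 : ℚ) < (w (κ i)).num := by exact_mod_cast Rat.num_pos.mpr (hw (κ i))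
        rw [ratio_eq (hw (κ i)), lt_div_iff₀ h2] at h1
        have : (0 : ℚ) < (w (κ i)).den - (w (κ i)).num := by linarith
        exact_mod_cast this
      have hnum_le : ((w i).num : ℚ) ≤ (w (κ i)).den - (w (κ i)).num := by
        exact_mod_cast Int.le_of_dvd hpos hdvd
      obtain ⟨b, P, M, hb, h1, h2, hM1, hMP, hc2, hc3⟩ :=
        ih (U.erase i) (κ i) (fun j => Finset.mem_erase.mpr ⟨hnotper j, hU (j + 1)⟩)
          (herase.trans hnum_le) hcard
      have hk1 : 1 ≤ k := by
        rw [← hcard]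
        exact Finset.card_pos.mpr ⟨κ i, Finset.mem_erase.mpr ⟨hnotper 0, hU 1⟩⟩
      have ha2 : (2 : ℤ) ≤ a i := by exact_mod_cast ha i
      have hP : 1 ≤ P := hM1.trans hMP
      have hprod : ∏ j ∈ U, (1 - w j) / w j = b * (a i * P) * (1 - w i) := by
        rw [← hsplit, h1, ← hi]
        have := (hw i).ne'
        field_simp
      have haP : 2 * P ≤ a i * P := mul_le_mul_of_nonneg_right ha2 (by omega)
      -- As `b aᵢ P wᵢ = b P (1 - w_{κ i})` is the product over `U.erase i`, the product over `U` is
      -- `b aᵢ P` minus it: the sign alternates and `M` becomes `aᵢ P - M`. For three or more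
      -- indices, `M < P` at the previous stage gives `P ≥ 2` and `2P - M ≥ P + 1 ≥ 3`.
      refine ⟨b, a i * P, a i * P - M, hb, by rw [hprod]; push_cast; ring, ?_, by omega, by omega,
        fun _ => by omega, fun h3 => ?_⟩
      · have : ∏ j ∈ U, (1 - w j) / w j = b * (a i * P) - ∏ j ∈ U.erase i, (1 - w j) / w j := by
          rw [hprod, h1, ← hi]
          ring
        rw [this, h2]
        push_cast
        ring
      · have := hc2 (by omega)
        omega

theorem prime_ne_of_weights [Fintype ι] (hw : ∀ i, 0 < w i) (ha : ∀ i, 2 ≤ a i)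
    (h : ∀ i, (a i : ℚ) * w i = 1 - w (κ i)) (hn : 3 ≤ Fintype.card ι) {μ p : ℕ} (hμ : μ.Prime)
    (hp : p.Prime) (hprod : ∏ i, (1 - w i) / w i = μ) :
    (μ : ℤ) ≠ 2 * p + (-1) ^ Fintype.card ι := by
  intro hμp
  have hw2 := weight_lt_half hw ha h
  have hnum : ∀ i, (0 : ℚ) < (w i).num := fun i => by exact_mod_cast Rat.num_pos.mpr (hw i)
  have hint : (μ : ℤ) * ∏ i, (w i).num = ∏ i, ((w i).den - (w i).num : ℤ) := by
    have h1 : (μ : ℚ) * ∏ i, ((w i).num : ℚ) = ∏ i, ((w i).den - (w i).num : ℚ) := by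
      rw [← hprod, ← Finset.prod_mul_distrib]
      refine Finset.prod_congr rfl fun i _ => ?_
      rw [ratio_eq (hw i), div_mul_cancel₀ _ (hnum i).ne']
    exact_mod_cast h1
  obtain ⟨i, -, hi⟩ := (Prime.dvd_finsetProd_iff (Nat.prime_iff_prime_int.mp hμ) _).mp
    (Dvd.intro _ hint)
  have hpos : (0 : ℤ) < (w i).den - (w i).num := by
    have h1 := one_lt_ratio (hw i) (hw2 i)
    rw [ratio_eq (hw i), lt_div_iff₀ (hnum i)] at h1
    have : (0 : ℚ) < (w i).den - (w i).num := by linarith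
    exact_mod_cast this
  have hle : (μ : ℚ) ≤ (w i).den - (w i).num := by exact_mod_cast Int.le_of_dvd hpos hi
  obtain ⟨b, P, M, hb, -, hN, -, -, -, hM⟩ :=
    exists_chain hw ha h Finset.univ i (fun _ => Finset.mem_univ _) (by rwa [hprod])
  have hM3 := hM hn
  rw [hprod, Finset.card_univ] at hN
  have hN' : (μ : ℤ) = b * M + (-1) ^ Fintype.card ι := by exact_mod_cast hN
  have hbM : b * M = 2 * p := by linarith
  have hp' := Nat.prime_iff_prime_int.mp hp
  have hp0 : (0 : ℤ) < p := by exact_mod_cast hp.pos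
  -- The prime `p` divides `b` or `M`; the other factor then divides 2 although it is at least 3.
  rcases hp'.dvd_or_dvd (Dvd.intro_left 2 hbM.symm) with ⟨c, rfl⟩ | ⟨c, rfl⟩
  · have h1 : c * M = 2 := mul_left_cancel₀ hp0.ne' (by linarith)
    have := Int.le_of_dvd two_pos (Dvd.intro_left c h1)
    omega
  · have h1 : b * c = 2 := mul_left_cancel₀ hp0.ne' (by linarith)
    have := Int.le_of_dvd two_pos (Dvd.intro c h1)
    omega

end Arithmetic

/-! ### Regular sequences in Noetherian local rings -/

section RegularSequences

open IsLocalRing RingTheory.Sequence Module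

variable {R : Type*} [CommRing R]

theorem isSMulRegular_quotient_iff {I : Ideal R} {r : R} :
    IsSMulRegular (R ⧸ I) r ↔ ∀ x, r * x ∈ I → x ∈ I := by
  rw [isSMulRegular_iff_right_eq_zero_of_smul]
  refine ⟨fun h x hx => ?_, fun h x hx => ?_⟩
  · refine Ideal.Quotient.eq_zero_iff_mem.mp (h (Ideal.Quotient.mk I x) ?_)
    rwa [← Ideal.Quotient.eq_zero_iff_mem] at hx
  · obtain ⟨y, rfl⟩ := Ideal.Quotient.mk_surjective x
    exact Ideal.Quotient.eq_zero_iff_mem.mpr (h y (Ideal.Quotient.eq_zero_iff_mem.mp hx))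

/-- `(R ⧸ I) ⧸ J (R ⧸ I)` is `R ⧸ (I + J)`. -/
noncomputable def quotientSMulTopEquiv (I J : Ideal R) :
    ((R ⧸ I) ⧸ (J • ⊤ : Submodule R (R ⧸ I))) ≃ₗ[R] R ⧸ (I ⊔ J) :=
  (Submodule.quotEquivOfEq _ _ (by
    rw [← Submodule.range_mkQ I, ← Submodule.map_top, ← Submodule.map_smul'', smul_eq_mul,
      Ideal.mul_top])).trans
    (Submodule.quotientQuotientEquivQuotientSup (M := R) I J)

theorem isWeaklyRegular_quotient_bot_iff {rs : List R} :
    IsWeaklyRegular (R ⧸ (⊥ : Ideal R)) rs ↔ IsWeaklyRegular R rs :=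
  (Submodule.quotEquivOfEqBot (⊥ : Ideal R) rfl).isWeaklyRegular_congr rs

theorem isWeaklyRegular_quotient_append {I : Ideal R} {rs ss : List R} :
    IsWeaklyRegular (R ⧸ I) (rs ++ ss) ↔
      IsWeaklyRegular (R ⧸ I) rs ∧ IsWeaklyRegular (R ⧸ (I ⊔ Ideal.ofList rs)) ss := by
  rw [isWeaklyRegular_append_iff, (quotientSMulTopEquiv I _).isWeaklyRegular_congr]

theorem isWeaklyRegular_quotient_cons {I : Ideal R} {r : R} {rs : List R} :
    IsWeaklyRegular (R ⧸ I) (r :: rs) ↔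
      (∀ x, r * x ∈ I → x ∈ I) ∧ IsWeaklyRegular (R ⧸ (I ⊔ Ideal.span {r})) rs := by
  rw [← List.singleton_append, isWeaklyRegular_quotient_append, isWeaklyRegular_singleton_iff,
    isSMulRegular_quotient_iff, Ideal.ofList_singleton]

theorem isWeaklyRegular_quotient_snoc {I : Ideal R} {r : R} {rs : List R} :
    IsWeaklyRegular (R ⧸ I) (rs ++ [r]) ↔
      IsWeaklyRegular (R ⧸ I) rs ∧ ∀ x, r * x ∈ I ⊔ Ideal.ofList rs → x ∈ I ⊔ Ideal.ofList rs := by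
  rw [isWeaklyRegular_quotient_append, isWeaklyRegular_singleton_iff, isSMulRegular_quotient_iff]

/-- Modulo `J` some power of `f` is a multiple of `z`, so whatever `z` kills is killed by that power
of a nonzerodivisor. This allows the last element of a regular sequence to be exchanged. -/
theorem mem_of_mul_mem_of_mem_radical {J : Ideal R} {f z : R}
    (hf : ∀ x, f * x ∈ J → x ∈ J) (hz : f ∈ (J ⊔ Ideal.span {z}).radical) (x : R)
    (hx : z * x ∈ J) : x ∈ J := by
  obtain ⟨N, hN⟩ := hz
  obtain ⟨j, hj, u, hu, h⟩ := Submodule.mem_sup.mp hN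
  obtain ⟨v, rfl⟩ := Ideal.mem_span_singleton'.mp hu
  have h1 : f ^ N * x ∈ J := by
    rw [← h, add_mul, mul_assoc]
    exact J.add_mem (J.mul_mem_right _ hj) (J.mul_mem_left _ hx)
  clear h hN
  induction N with
  | zero => simpa using h1
  | succ N ih => exact ih (hf _ (by rwa [← mul_assoc, ← pow_succ']))

variable [IsLocalRing R]

theorem maximalIdeal_le_radical_iff {K : Ideal R} :
    maximalIdeal R ≤ K.radical ↔ ∀ Q : Ideal R, Q.IsPrime → K ≤ Q → Q = maximalIdeal R := by
  refine ⟨fun h Q hQ hKQ => le_antisymm (le_maximalIdeal hQ.ne_top)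
    (h.trans (hQ.radical_le_iff.mpr hKQ)), fun h => ?_⟩
  rw [Ideal.radical_eq_sInf]
  exact le_sInf fun Q hQ => (h Q hQ.2 hQ.1).ge

theorem ringKrullDim_quotient_le_zero_iff {K : Ideal R} :
    ringKrullDim (R ⧸ K) ≤ 0 ↔ maximalIdeal R ≤ K.radical := by
  have h0 : ringKrullDim (R ⧸ K) ≤ 0 ↔ Ring.KrullDimLE 0 (R ⧸ K) := by
    rw [Ring.krullDimLE_iff]
    rfl
  rw [h0, Ring.krullDimLE_zero_iff, maximalIdeal_le_radical_iff]
  refine ⟨fun h Q hQ hKQ => ?_, fun h P hP => ?_⟩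
  · have hker : RingHom.ker (Ideal.Quotient.mk K) ≤ Q := by rwa [Ideal.mk_ker]
    have h1 := h _ (Ideal.map_isPrime_of_surjective Ideal.Quotient.mk_surjective hker)
    have h2 := Ideal.comap_isMaximal_of_surjective (Ideal.Quotient.mk K)
      Ideal.Quotient.mk_surjective (K := Q.map (Ideal.Quotient.mk K))
    rw [Ideal.comap_map_of_surjective' _ Ideal.Quotient.mk_surjective, sup_eq_left.mpr hker] at h2
    exact eq_maximalIdeal h2
  · have h1 := h (P.comap (Ideal.Quotient.mk K)) inferInstance (by
      intro x hx
      rw [Ideal.mem_comap, Ideal.Quotient.eq_zero_iff_mem.mpr hx]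
      exact P.zero_mem)
    have h2 : (P.comap (Ideal.Quotient.mk K)).IsMaximal := h1 ▸ maximalIdeal.isMaximal R
    have h3 := Ideal.map_eq_top_or_isMaximal_of_surjective (Ideal.Quotient.mk K)
      Ideal.Quotient.mk_surjective h2
    rw [Ideal.map_comap_of_surjective _ Ideal.Quotient.mk_surjective] at h3
    exact h3.resolve_left hP.ne_top

variable [IsNoetherianRing R]

/-- A dimension count: dividing by `f` lowers the dimension by at most one, so `R ⧸ J` has dimension
at most 1; avoiding the minimal primes of `J` makes `z` lower it by at least one. -/
theorem maximalIdeal_le_radical_sup_of_notMem {J : Ideal R} {f z : R} (hf : f ∈ maximalIdeal R)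
    (hJ : maximalIdeal R ≤ (J ⊔ Ideal.span {f}).radical)
    (hz : ∀ P ∈ J.minimalPrimes, P ≠ maximalIdeal R → z ∉ P) :
    maximalIdeal R ≤ (J ⊔ Ideal.span {z}).radical := by
  -- If the maximal ideal is minimal over `J`, avoiding the other minimal primes says nothing about
  -- it, but then `J` is already primary to it.
  by_cases hm : maximalIdeal R ∈ J.minimalPrimes
  · rw [maximalIdeal_le_radical_iff]
    exact fun Q hQ hKQ => le_antisymm (le_maximalIdeal hQ.ne_top)
      (hm.2 ⟨hQ, le_sup_left.trans hKQ⟩ (le_maximalIdeal hQ.ne_top))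
  · have e : ∀ r : R, supportDim R (QuotSMulTop r (R ⧸ J)) =
        ringKrullDim (R ⧸ (J ⊔ Ideal.span {r})) := by
      intro r
      rw [← supportDim_quotient_eq_ringKrullDim]
      refine supportDim_eq_of_equiv (LinearEquiv.trans (Submodule.quotEquivOfEq _ _ ?_)
        (quotientSMulTopEquiv J (Ideal.span {r})))
      rw [Submodule.ideal_span_singleton_smul]
    have h1 := supportDim_le_supportDim_quotSMulTop_succ (M := R ⧸ J) hf
    have h2 := supportDim_quotSMulTop_succ_le_of_notMem_minimalPrimes (M := R ⧸ J) (x := z) (by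
      rw [Ideal.annihilator_quotient]
      exact fun P hP => hz P hP (fun h => hm (h ▸ hP)))
    rw [e] at h1 h2
    rw [← ringKrullDim_quotient_le_zero_iff] at hJ ⊢
    have h3 : ringKrullDim (R ⧸ (J ⊔ Ideal.span {z})) + 1 ≤ 0 + 1 :=
      (h2.trans h1).trans (by gcongr)
    exact ENat.WithBot.add_le_add_one_right_iff.mp h3

/-- Prime avoidance: both ideals have finitely many minimal primes, and none other than the maximal
ideal contains it. -/
theorem exists_mem_maximalIdeal_notMem_minimalPrimes (J K : Ideal R) :
    ∃ z ∈ maximalIdeal R, (∀ P ∈ J.minimalPrimes, P ≠ maximalIdeal R → z ∉ P) ∧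
      ∀ P ∈ K.minimalPrimes, P ≠ maximalIdeal R → z ∉ P := by
  by_contra hcon
  push Not at hcon
  have hfin : ((J.minimalPrimes ∪ K.minimalPrimes) \ {maximalIdeal R}).Finite :=
    (J.finite_minimalPrimes_of_isNoetherianRing.union
      K.finite_minimalPrimes_of_isNoetherianRing).subset Set.sdiff_subset
  have hprime : ∀ P ∈ (J.minimalPrimes ∪ K.minimalPrimes) \ {maximalIdeal R}, P.IsPrime := by
    rintro P ⟨hP | hP, -⟩
    · exact hP.1.1
    · exact hP.1.1
  obtain ⟨P, hP, hle⟩ := (Ideal.subset_union_prime_finite hfin (f := id) (I := maximalIdeal R) ⊥ ⊥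
    (fun P hP _ _ => hprime P hP)).mp (by
      intro z hz
      simp only [Set.mem_iUnion, id]
      by_cases h1 : ∀ P ∈ J.minimalPrimes, P ≠ maximalIdeal R → z ∉ P
      · obtain ⟨P, hP, hne, hzP⟩ := hcon z hz h1
        exact ⟨P, ⟨Or.inr hP, hne⟩, hzP⟩
      · push Not at h1
        obtain ⟨P, hP, hne, hzP⟩ := h1
        exact ⟨P, ⟨Or.inl hP, hne⟩, hzP⟩)
  exact hP.2 (le_antisymm (le_maximalIdeal (hprime P hP).ne_top) hle)

/-- In a Noetherian local ring, if some sequence of length `n` which generates an ideal primary to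
the maximal ideal of `R ⧸ I` is regular on `R ⧸ I`, then so is every such sequence. -/
theorem isWeaklyRegular_of_maximalIdeal_le_radical (I : Ideal R) (fs gs : List R)
    (hlen : fs.length = gs.length) (hfm : ∀ f ∈ fs, f ∈ maximalIdeal R)
    (hgm : ∀ g ∈ gs, g ∈ maximalIdeal R) (hf : maximalIdeal R ≤ (I ⊔ Ideal.ofList fs).radical)
    (hg : maximalIdeal R ≤ (I ⊔ Ideal.ofList gs).radical)
    (hreg : IsWeaklyRegular (R ⧸ I) fs) : IsWeaklyRegular (R ⧸ I) gs := by
  induction hn : gs.length generalizing I fs gs with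
  | zero =>
    rw [List.length_eq_zero_iff.mp hn]
    exact .nil R _
  | succ n ih =>
    obtain ⟨fs, f, rfl⟩ : ∃ l a, fs = l ++ [a] :=
      ⟨_, _, (List.dropLast_append_getLast (l := fs) (by
        rw [← List.length_pos_iff]; omega)).symm⟩
    obtain ⟨gs, g, rfl⟩ : ∃ l a, gs = l ++ [a] :=
      ⟨_, _, (List.dropLast_append_getLast (l := gs) (by
        rw [← List.length_pos_iff]; omega)).symm⟩
    simp only [List.length_append, List.length_singleton, Nat.add_right_cancel_iff] at hlen hn
    simp only [List.mem_append, List.mem_singleton, or_imp, forall_and, forall_eq] at hfm hgm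
    rw [Ideal.ofList_append, Ideal.ofList_singleton, ← sup_assoc] at hf hg
    -- A common last element: replace `f` by `z`, permute `z` to the front, apply induction modulo
    -- `z`, permute back, and replace `z` by `g`.
    obtain ⟨z, hz, hzf, hzg⟩ := exists_mem_maximalIdeal_notMem_minimalPrimes
      (I ⊔ Ideal.ofList fs) (I ⊔ Ideal.ofList gs)
    have hf' := maximalIdeal_le_radical_sup_of_notMem hfm.2 hf hzf
    have hg' := maximalIdeal_le_radical_sup_of_notMem hgm.2 hg hzg
    have hswap : ∀ l : List R, (∀ a ∈ l, a ∈ maximalIdeal R) →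
        (IsWeaklyRegular (R ⧸ I) (l ++ [z]) ↔ IsWeaklyRegular (R ⧸ I) (z :: l)) := by
      intro l hl
      have hmem : ∀ r ∈ z :: l, r ∈ maximalIdeal R := by
        simpa using ⟨hz, hl⟩
      have hperm : List.Perm (l ++ [z]) (z :: l) := List.perm_append_singleton z l
      exact ⟨fun h => isWeaklyRegular_of_perm_of_subset_maximalIdeal h hperm
          (fun r hr => hmem r (hperm.mem_iff.mp hr)),
        fun h => isWeaklyRegular_of_perm_of_subset_maximalIdeal h hperm.symm hmem⟩
    rw [isWeaklyRegular_quotient_snoc] at hreg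
    have h1 : IsWeaklyRegular (R ⧸ I) (fs ++ [z]) :=
      isWeaklyRegular_quotient_snoc.mpr ⟨hreg.1,
        mem_of_mul_mem_of_mem_radical hreg.2 (hf' hfm.2)⟩
    rw [hswap fs hfm.1, isWeaklyRegular_quotient_cons] at h1
    have h2 := ih (I ⊔ Ideal.span {z}) fs gs hlen hfm.1 hgm.1
      (by rwa [sup_right_comm]) (by rwa [sup_right_comm]) h1.2 hn
    have h3 := (hswap gs hgm.1).mpr (isWeaklyRegular_quotient_cons.mpr ⟨h1.1, h2⟩)
    rw [isWeaklyRegular_quotient_snoc] at h3 ⊢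
    exact ⟨h3.1, mem_of_mul_mem_of_mem_radical h3.2 (hg hz)⟩

end RegularSequences

/-! ### Truncation by weight and homogeneous ideals -/

section WeightFiltration

open MvPolynomial Finsupp RingTheory.Sequence

variable {σ K : Type*} [Field K]

/-- The part of a polynomial which consists of the monomials of weight less than `k`. -/
noncomputable def lowPart (w : σ → ℕ) (k : ℕ) : MvPolynomial σ K →ₗ[K] MvPolynomial σ K :=
  ∑ j ∈ Finset.range k, weightedHomogeneousComponent w j

variable {w : σ → ℕ}

theorem coeff_lowPart (k : ℕ) (p : MvPolynomial σ K) (α : σ →₀ ℕ) :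
    coeff α (lowPart w k p) = if weight w α < k then coeff α p else 0 := by
  rw [lowPart, LinearMap.sum_apply, coeff_sum]
  simp_rw [coeff_weightedHomogeneousComponent]
  simp

theorem lowPart_eq_zero_iff {k : ℕ} {p : MvPolynomial σ K} :
    lowPart w k p = 0 ↔ ∀ α, weight w α < k → coeff α p = 0 := by
  simp only [MvPolynomial.ext_iff, coeff_lowPart, coeff_zero, ite_eq_right_iff]

theorem lowPart_eq_self_iff {k : ℕ} {p : MvPolynomial σ K} :
    lowPart w k p = p ↔ ∀ α, k ≤ weight w α → coeff α p = 0 := by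
  simp only [MvPolynomial.ext_iff, coeff_lowPart, ← not_lt]
  refine forall_congr' fun α => ?_
  split_ifs with h <;> simp [h, eq_comm]

theorem lowPart_lowPart (k l : ℕ) (p : MvPolynomial σ K) :
    lowPart w k (lowPart w l p) = lowPart w (min k l) p := by
  ext α
  simp only [coeff_lowPart, lt_min_iff, ite_and]

theorem lowPart_mul_eq_zero {a b : ℕ} {p q : MvPolynomial σ K} (hp : lowPart w a p = 0)
    (hq : lowPart w b q = 0) : lowPart w (a + b) (p * q) = 0 := by
  classical
  rw [lowPart_eq_zero_iff] at *
  intro α hα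
  rw [coeff_mul]
  refine Finset.sum_eq_zero fun x hx => ?_
  rw [← Finset.HasAntidiagonal.mem_antidiagonal.mp hx, map_add] at hα
  rcases lt_or_ge (weight w x.1) a with h | h
  · rw [hp _ h, zero_mul]
  · rw [hq _ (by omega), mul_zero]

theorem exists_lowPart_eq_self (p : MvPolynomial σ K) : ∃ k, lowPart w k p = p := by
  refine ⟨p.support.sup (weight w) + 1, lowPart_eq_self_iff.mpr fun α hα => ?_⟩
  by_contra h
  have := Finset.le_sup (f := weight w) (MvPolynomial.mem_support_iff.mpr h)
  omega

/-- Multiplication by `g` shifts weights by exactly `e`. For `k ≤ e` the truncated subtraction gives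
0 and both sides vanish. -/
theorem lowPart_homogeneous_mul {g : MvPolynomial σ K} {e : ℕ} (hg : IsWeightedHomogeneous w g e)
    (k : ℕ) (u : MvPolynomial σ K) : lowPart w k (g * u) = g * lowPart w (k - e) u := by
  classical
  have h1 : lowPart w k (g * (u - lowPart w (k - e) u)) = 0 := by
    have hg' : lowPart w e g = 0 := lowPart_eq_zero_iff.mpr fun α hα => hg.coeff_eq_zero α hα.ne
    have hu : lowPart w (k - e) (u - lowPart w (k - e) u) = 0 := by
      rw [map_sub, lowPart_lowPart, min_self, sub_self]
    have h2 := lowPart_mul_eq_zero hg' hu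
    rw [lowPart_eq_zero_iff] at h2 ⊢
    exact fun α hα => h2 α (by omega)
  have h3 : lowPart w k (g * lowPart w (k - e) u) = g * lowPart w (k - e) u := by
    rw [lowPart_eq_self_iff]
    intro α hα
    rw [coeff_mul]
    refine Finset.sum_eq_zero fun x hx => ?_
    rw [← Finset.HasAntidiagonal.mem_antidiagonal.mp hx, map_add] at hα
    by_cases h : weight w x.1 = e
    · rw [coeff_lowPart, if_neg (by omega), mul_zero]
    · rw [hg.coeff_eq_zero _ h, zero_mul]
  rw [mul_sub, map_sub, h3, sub_eq_zero] at h1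
  exact h1

/-- An ideal is homogeneous with respect to `w` if it is stable under truncation by weight. -/
def IsHomogeneousIdeal (w : σ → ℕ) (I : Ideal (MvPolynomial σ K)) : Prop :=
  ∀ p ∈ I, ∀ k, lowPart w k p ∈ I

theorem isHomogeneousIdeal_bot : IsHomogeneousIdeal w (⊥ : Ideal (MvPolynomial σ K)) := by
  intro p hp k
  rw [Ideal.mem_bot.mp hp, map_zero]
  exact zero_mem _

theorem IsHomogeneousIdeal.sup_span {I : Ideal (MvPolynomial σ K)} (hI : IsHomogeneousIdeal w I)
    {g : MvPolynomial σ K} {e : ℕ} (hg : IsWeightedHomogeneous w g e) :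
    IsHomogeneousIdeal w (I ⊔ Ideal.span {g}) := by
  intro p hp k
  obtain ⟨i, hi, v, hv, rfl⟩ := Submodule.mem_sup.mp hp
  obtain ⟨u, rfl⟩ := Ideal.mem_span_singleton'.mp hv
  rw [map_add, mul_comm, lowPart_homogeneous_mul hg]
  exact Submodule.add_mem_sup (hI i hi k)
    (Ideal.mul_mem_right _ _ (Ideal.mem_span_singleton_self g))

/-- Positive weights make `s` a nonzero constant plus terms of positive weight, so the components of
`u` can be extracted from `s * u` one weight at a time. Hence localizing at the origin loses nothing
modulo a homogeneous ideal. -/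
theorem IsHomogeneousIdeal.mem_of_mul_mem {I : Ideal (MvPolynomial σ K)}
    (hI : IsHomogeneousIdeal w I) (hw : ∀ i, w i ≠ 0) {s u : MvPolynomial σ K}
    (hs : constantCoeff s ≠ 0) (hu : s * u ∈ I) : u ∈ I := by
  have key : ∀ k, lowPart w k u ∈ I := by
    intro k
    induction k with
    | zero => simp [lowPart]
    | succ k ih =>
      have h1 : s * (u - lowPart w k u) ∈ I := by
        rw [mul_sub]
        exact I.sub_mem hu (I.mul_mem_left _ ih)
      have h2 : lowPart w k (u - lowPart w k u) = 0 := by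
        rw [map_sub, lowPart_lowPart, min_self, sub_self]
      have h3 : lowPart w 1 (s - C (constantCoeff s)) = 0 := by
        rw [lowPart_eq_zero_iff]
        intro α hα
        have : α = 0 := by
          ext x
          exact (MvPolynomial.weightedDegree_eq_zero_iff
            (MvPolynomial.nonTorsionWeight_of hw)).mp (by omega) x
        rw [this, coeff_sub, coeff_zero_C, constantCoeff_eq, sub_self]
      have h4 := lowPart_mul_eq_zero h3 h2
      -- Truncated below weight `k + 1`, only the constant term of `s` times the weight `k`
      -- component of `u` survives.
      have h5 := hI _ h1 (1 + k)
      rw [sub_mul, map_sub, sub_eq_zero] at h4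
      rw [h4, C_mul', map_smul, map_sub, lowPart_lowPart, min_eq_right (by omega), add_comm] at h5
      have h6 := I.mul_mem_left (C (constantCoeff s)⁻¹) h5
      rw [C_mul', smul_smul, inv_mul_cancel₀ hs, one_smul] at h6
      simpa using I.add_mem h6 ih
  obtain ⟨k, hk⟩ := exists_lowPart_eq_self (w := w) u
  exact hk ▸ key k

/-- A sequence of weighted homogeneous polynomials which is regular in the local ring at the
origin is regular in the polynomial ring. -/
theorem isWeaklyRegular_of_localization (hw : ∀ i, w i ≠ 0) (m : Ideal (MvPolynomial σ K))
    [m.IsPrime] (hm : m = RingHom.ker (constantCoeff (σ := σ) (R := K)))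
    {gs : List (MvPolynomial σ K)} (hg : ∀ g ∈ gs, ∃ e, IsWeightedHomogeneous w g e)
    {I : Ideal (MvPolynomial σ K)} (hI : IsHomogeneousIdeal w I)
    (h : IsWeaklyRegular (Localization.AtPrime m ⧸
        I.map (algebraMap (MvPolynomial σ K) (Localization.AtPrime m)))
      (gs.map (algebraMap (MvPolynomial σ K) (Localization.AtPrime m)))) :
    IsWeaklyRegular (MvPolynomial σ K ⧸ I) gs := by
  induction gs generalizing I with
  | nil => exact .nil _ _
  | cons g gs ih =>
    simp only [List.mem_cons, forall_eq_or_imp] at hg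
    obtain ⟨e, he⟩ := hg.1
    rw [List.map_cons, isWeaklyRegular_quotient_cons] at h
    rw [isWeaklyRegular_quotient_cons]
    refine ⟨fun u hu => ?_, ih hg.2 (hI.sup_span he) ?_⟩
    · have h1 := h.1 (algebraMap _ _ u) (by
        rw [← map_mul]
        exact Ideal.mem_map_of_mem _ hu)
      rw [IsLocalization.algebraMap_mem_map_algebraMap_iff m.primeCompl] at h1
      obtain ⟨s, hs, hsu⟩ := h1
      refine hI.mem_of_mul_mem hw (s := s) (fun h0 => hs ?_) hsu
      rw [hm]
      exact h0
    · rw [Ideal.map_sup, Ideal.map_span, Set.image_singleton]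
      exact h.2

/-- The polynomials all of whose monomials have weight less than `k`. -/
noncomputable def lowSubmodule (K : Type*) [Field K] (w : σ → ℕ) (k : ℕ) :
    Submodule K (MvPolynomial σ K) :=
  LinearMap.range (lowPart w k)

end WeightFiltration

/-! ### Hilbert series and codimension -/

section HilbertSeries

open MvPolynomial Finsupp RingTheory.Sequence

variable {σ K : Type*} [Field K] {w : σ → ℕ}

theorem finite_lowSubmodule [Finite σ] (hw : ∀ i, w i ≠ 0) (k : ℕ) :
    Module.Finite K (lowSubmodule K w k) := by
  have h1 : lowSubmodule K w k ≤ (Finset.range k).sup (weightedHomogeneousSubmodule K w) := by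
    rintro _ ⟨p, rfl⟩
    rw [lowPart, LinearMap.sum_apply]
    exact Submodule.sum_mem _ fun j hj =>
      Finset.le_sup (f := weightedHomogeneousSubmodule K w) hj
        (weightedHomogeneousComponent_mem w p j)
  have h2 : ((Finset.range k).sup (weightedHomogeneousSubmodule K w)).FG :=
    Submodule.fg_finset_sup _ _ fun j _ => weightedHomogeneousSubmodule_fg K w hw j
  have := Module.Finite.iff_fg.mpr h2
  exact Submodule.finiteDimensional_of_le h1

/-- The image of the polynomials of weight less than `k` in the quotient by an ideal. -/
noncomputable def lowQuotient (w : σ → ℕ) (I : Ideal (MvPolynomial σ K)) (k : ℕ) :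
    Submodule K (MvPolynomial σ K ⧸ I) :=
  (lowSubmodule K w k).map (Ideal.Quotient.mkₐ K I).toLinearMap

theorem mem_lowQuotient {I : Ideal (MvPolynomial σ K)} {k : ℕ} {x : MvPolynomial σ K ⧸ I} :
    x ∈ lowQuotient w I k ↔ ∃ p, Ideal.Quotient.mk I (lowPart w k p) = x := by
  simp [lowQuotient, lowSubmodule]

/-- Multiplication by `g` is injective modulo `I` and identifies the part below `k - e` with the
kernel of the projection from the part below `k`; then rank–nullity applies. -/
theorem finrank_lowQuotient_sup_span [Finite σ] (hw : ∀ i, w i ≠ 0)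
    {I : Ideal (MvPolynomial σ K)} (hI : IsHomogeneousIdeal w I) {g : MvPolynomial σ K} {e : ℕ}
    (hg : IsWeightedHomogeneous w g e) (hreg : ∀ x, g * x ∈ I → x ∈ I) (k : ℕ) :
    Module.finrank K (lowQuotient w I k) =
      Module.finrank K (lowQuotient w (I ⊔ Ideal.span {g}) k) +
        Module.finrank K (lowQuotient w I (k - e)) := by
  have := finite_lowSubmodule (K := K) hw k
  have hfin : Module.Finite K (lowQuotient w I k) := by
    unfold lowQuotient
    infer_instance
  let φ : (MvPolynomial σ K ⧸ I) →ₗ[K] MvPolynomial σ K ⧸ I :=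
    LinearMap.mulLeft K (Ideal.Quotient.mk I g)
  let π : (MvPolynomial σ K ⧸ I) →ₗ[K] MvPolynomial σ K ⧸ (I ⊔ Ideal.span {g}) :=
    (Ideal.Quotient.factorₐ K (le_sup_left : I ≤ I ⊔ Ideal.span {g})).toLinearMap
  have hπ : ∀ p, π (Ideal.Quotient.mk I p) = Ideal.Quotient.mk _ p := fun p => rfl
  have hφ : Function.Injective φ := by
    rw [← LinearMap.ker_eq_bot, LinearMap.ker_eq_bot']
    intro x hx
    obtain ⟨p, rfl⟩ := Ideal.Quotient.mk_surjective x
    rw [LinearMap.mulLeft_apply, ← map_mul, Ideal.Quotient.eq_zero_iff_mem] at hx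
    exact Ideal.Quotient.eq_zero_iff_mem.mpr (hreg p hx)
  have hrange : (lowQuotient w I k).map π = lowQuotient w (I ⊔ Ideal.span {g}) k := by
    rw [lowQuotient, ← Submodule.map_comp]
    rfl
  have hker : lowQuotient w I k ⊓ LinearMap.ker π = (lowQuotient w I (k - e)).map φ := by
    ext x
    constructor
    · rintro ⟨h1, h2⟩
      obtain ⟨p, rfl⟩ := mem_lowQuotient.mp h1
      replace h2 := Ideal.Quotient.eq_zero_iff_mem.mp ((hπ _).symm.trans (LinearMap.mem_ker.mp h2))
      obtain ⟨i, hi, v, hv, hiv⟩ := Submodule.mem_sup.mp h2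
      obtain ⟨u, rfl⟩ := Ideal.mem_span_singleton'.mp hv
      refine ⟨_, mem_lowQuotient.mpr ⟨u, rfl⟩, ?_⟩
      have h3 := congrArg (lowPart w k) hiv
      rw [map_add, lowPart_lowPart, min_self, mul_comm, lowPart_homogeneous_mul hg] at h3
      rw [LinearMap.mulLeft_apply, ← map_mul, ← h3, map_add,
        Ideal.Quotient.eq_zero_iff_mem.mpr (hI i hi k), zero_add]
    · rintro ⟨_, h1, rfl⟩
      obtain ⟨p, rfl⟩ := mem_lowQuotient.mp h1
      rw [LinearMap.mulLeft_apply, ← map_mul, ← lowPart_homogeneous_mul hg]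
      refine ⟨mem_lowQuotient.mpr ⟨_, rfl⟩, ?_⟩
      refine LinearMap.mem_ker.mpr ((hπ _).trans (Ideal.Quotient.eq_zero_iff_mem.mpr ?_))
      rw [lowPart_homogeneous_mul hg]
      exact Ideal.mem_sup_right (Ideal.mul_mem_right _ _ (Ideal.mem_span_singleton_self g))
  have h := LinearMap.finrank_range_add_finrank_ker (π.domRestrict (lowQuotient w I k))
  rw [LinearMap.range_domRestrict, hrange] at h
  rw [← h]
  congr 1
  rw [(Submodule.equivMapOfInjective φ hφ _).finrank_eq, ← hker, ← Submodule.map_comap_subtype,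
    Submodule.finrank_map_subtype_eq]
  rfl

/-- The generating series of the dimensions of the spaces `lowQuotient w I k`. -/
noncomputable def lowSeries (w : σ → ℕ) (I : Ideal (MvPolynomial σ K)) : PowerSeries ℤ :=
  PowerSeries.mk fun k => (Module.finrank K (lowQuotient w I k) : ℤ)

theorem finrank_lowQuotient_zero (I : Ideal (MvPolynomial σ K)) :
    Module.finrank K (lowQuotient w I 0) = 0 := by
  have : lowQuotient w I 0 = ⊥ := by
    rw [Submodule.eq_bot_iff]
    intro x hx
    obtain ⟨p, rfl⟩ := mem_lowQuotient.mp hx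
    simp [lowPart]
  rw [this, finrank_bot]

theorem lowSeries_sup_ofList [Finite σ] (hw : ∀ i, w i ≠ 0) {ι : Type*}
    {g : ι → MvPolynomial σ K} {e : ι → ℕ} (hg : ∀ i, IsWeightedHomogeneous w (g i) (e i))
    (l : List ι) {I : Ideal (MvPolynomial σ K)} (hI : IsHomogeneousIdeal w I)
    (hreg : IsWeaklyRegular (MvPolynomial σ K ⧸ I) (l.map g)) :
    lowSeries w (I ⊔ Ideal.ofList (l.map g)) =
      (l.map fun i => (1 - PowerSeries.X ^ e i : PowerSeries ℤ)).prod * lowSeries w I := by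
  induction l generalizing I with
  | nil => simp
  | cons i l ih =>
    rw [List.map_cons, isWeaklyRegular_quotient_cons] at hreg
    rw [List.map_cons, Ideal.ofList_cons, ← sup_assoc, ih (hI.sup_span (hg i)) hreg.2,
      List.map_cons, List.prod_cons, mul_comm (1 - _), mul_assoc]
    congr 1
    ext k
    have h := finrank_lowQuotient_sup_span hw hI (hg i) hreg.1 k
    rw [sub_mul, one_mul, map_sub, PowerSeries.coeff_X_pow_mul']
    simp only [lowSeries, PowerSeries.coeff_mk, h]
    split_ifs with hk
    · push_cast
      ring
    · rw [Nat.sub_eq_zero_of_le (by omega), finrank_lowQuotient_zero]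
      simp

theorem isWeaklyRegular_X (l : List σ) (hl : l.Nodup) (s : Set σ) (hs : ∀ i ∈ l, i ∉ s) :
    IsWeaklyRegular (MvPolynomial σ K ⧸ Ideal.span (X '' s : Set (MvPolynomial σ K)))
      (l.map (X : σ → MvPolynomial σ K)) := by
  induction l generalizing s with
  | nil => exact .nil _ _
  | cons i l ih =>
    rw [List.map_cons, isWeaklyRegular_quotient_cons]
    rw [List.nodup_cons] at hl
    constructor
    · intro u hu
      rw [mem_ideal_span_X_image] at hu ⊢
      intro α hα
      obtain ⟨j, hj, hj0⟩ := hu (Finsupp.single i 1 + α) (by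
        rw [MvPolynomial.mem_support_iff, coeff_X_mul]
        exact MvPolynomial.mem_support_iff.mp hα)
      refine ⟨j, hj, ?_⟩
      have hij : i ≠ j := fun h => hs i List.mem_cons_self (h ▸ hj)
      simpa [Finsupp.single_apply, hij] using hj0
    · rw [← Ideal.span_union, ← Set.image_singleton, ← Set.image_union]
      refine ih hl.2 _ fun j hj => ?_
      rintro (h | h)
      · exact hs j (List.mem_cons_of_mem _ hj) h
      · exact hl.1 ((Set.mem_singleton_iff.mp h) ▸ hj)

/-- The tail is `D X^{k₀} / (1 - X)`, so multiplying by `1 - X` leaves a polynomial whose value at 1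
is `D`. -/
theorem lowSeries_of_eventually_const {I : Ideal (MvPolynomial σ K)} {k₀ D : ℕ}
    (h : ∀ k, k₀ ≤ k → Module.finrank K (lowQuotient w I k) = D) :
    lowSeries w I * (1 - PowerSeries.X) =
      ((PowerSeries.trunc k₀ (lowSeries w I) * (1 - Polynomial.X) +
        Polynomial.C (D : ℤ) * Polynomial.X ^ k₀ : Polynomial ℤ) : PowerSeries ℤ) := by
  have h1 : lowSeries w I =
      ((PowerSeries.trunc k₀ (lowSeries w I) : Polynomial ℤ) : PowerSeries ℤ) +
      PowerSeries.C (D : ℤ) * (PowerSeries.X ^ k₀ * PowerSeries.mk 1) := by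
    ext k
    rw [map_add, Polynomial.coeff_coe, PowerSeries.coeff_trunc, PowerSeries.coeff_C_mul,
      PowerSeries.coeff_X_pow_mul']
    rcases lt_or_ge k k₀ with hk | hk
    · rw [if_pos hk, if_neg (not_le.mpr hk), mul_zero, add_zero]
    · rw [if_neg (not_lt.mpr hk), if_pos hk, lowSeries, PowerSeries.coeff_mk, h k hk]
      simp
  have h2 := PowerSeries.mk_one_mul_one_sub_eq_one ℤ
  nth_rewrite 1 [h1]
  push_cast
  linear_combination PowerSeries.C (D : ℤ) * PowerSeries.X ^ k₀ * h2

theorem prod_one_sub_X_pow {ι : Type*} (s : Finset ι) (d : ι → ℕ) :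
    ∏ i ∈ s, (1 - Polynomial.X ^ d i : Polynomial ℤ) =
      (1 - Polynomial.X) ^ s.card *
        ∏ i ∈ s, ∑ j ∈ Finset.range (d i), (Polynomial.X : Polynomial ℤ) ^ j := by
  rw [← Finset.prod_const, ← Finset.prod_mul_distrib]
  exact Finset.prod_congr rfl fun i _ => (mul_neg_geom_sum _ _).symm

theorem ofList_map_univ [Fintype σ] {R : Type*} [CommRing R] (g : σ → R) :
    Ideal.ofList ((Finset.univ : Finset σ).toList.map g) = Ideal.span (Set.range g) := by
  rw [Ideal.ofList]
  congr 1
  ext x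
  simp

theorem weight_le_degree_mul [Fintype σ] (α : σ →₀ ℕ) :
    weight w α ≤ degree α * ∑ i, w i := by
  rw [weight_apply, Finsupp.sum_fintype _ _ (by simp), degree_eq_sum, Finset.sum_mul]
  refine Finset.sum_le_sum fun i _ => ?_
  rw [smul_eq_mul]
  exact Nat.mul_le_mul_left _ (Finset.single_le_sum (f := w) (fun _ _ => Nat.zero_le _)
    (Finset.mem_univ i))

theorem mem_of_lowPart_eq_zero [Fintype σ] {I : Ideal (MvPolynomial σ K)} {N : ℕ}
    (hN : ∀ α : σ →₀ ℕ, N ≤ degree α → monomial α (1 : K) ∈ I) {k : ℕ}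
    (hk : N * ∑ i, w i + 1 ≤ k) {p : MvPolynomial σ K} (hp : lowPart w k p = 0) : p ∈ I := by
  rw [lowPart_eq_zero_iff] at hp
  rw [p.as_sum]
  refine I.sum_mem fun α hα => ?_
  have h1 : k ≤ weight w α := by
    by_contra h
    exact MvPolynomial.mem_support_iff.mp hα (hp α (not_le.mp h))
  have h2 : N ≤ degree α := by
    by_contra h
    have h3 := weight_le_degree_mul (w := w) α
    have h4 := Nat.mul_le_mul_right (∑ i, w i) (not_le.mp h).le
    omega
  have h5 := I.mul_mem_left (C (coeff α p)) (hN α h2)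
  rwa [C_mul_monomial, mul_one] at h5

/-- A regular sequence of `n` weighted homogeneous polynomials of degrees `e i` which generates an
ideal of finite codimension has codimension `∏ e i / ∏ w i`. -/
theorem finrank_quotient_mul_prod [Fintype σ] (hw : ∀ i, w i ≠ 0) {g : σ → MvPolynomial σ K}
    {e : σ → ℕ} (hg : ∀ i, IsWeightedHomogeneous w (g i) (e i)) {N : ℕ}
    (hN : ∀ α : σ →₀ ℕ, N ≤ degree α → monomial α (1 : K) ∈ Ideal.span (Set.range g))
    (hreg : IsWeaklyRegular (MvPolynomial σ K ⧸ (⊥ : Ideal (MvPolynomial σ K)))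
      ((Finset.univ : Finset σ).toList.map g)) :
    Module.finrank K (MvPolynomial σ K ⧸ Ideal.span (Set.range g)) * ∏ i, w i = ∏ i, e i := by
  have hg1 := lowSeries_sup_ofList hw hg _ isHomogeneousIdeal_bot hreg
  have hregX := isWeaklyRegular_X (K := K) (Finset.univ : Finset σ).toList
    (Finset.nodup_toList _) ∅ (by simp)
  rw [Set.image_empty, Ideal.span_empty] at hregX
  have hX1 := lowSeries_sup_ofList (K := K) hw (g := X) (e := w)
    (fun i => isWeightedHomogeneous_X K w i) _ isHomogeneousIdeal_bot hregX
  rw [bot_sup_eq, ofList_map_univ, Finset.prod_map_toList] at hg1 hX1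
  have hD : ∀ k, N * ∑ i, w i + 1 ≤ k →
      Module.finrank K (lowQuotient w (Ideal.span (Set.range g)) k) =
        Module.finrank K (MvPolynomial σ K ⧸ Ideal.span (Set.range g)) := by
    intro k hk
    have : lowQuotient w (Ideal.span (Set.range g)) k = ⊤ := by
      rw [Submodule.eq_top_iff']
      intro x
      obtain ⟨p, rfl⟩ := Ideal.Quotient.mk_surjective x
      refine mem_lowQuotient.mpr ⟨p, Ideal.Quotient.eq.mpr ?_⟩
      refine mem_of_lowPart_eq_zero (w := w) hN hk ?_
      rw [map_sub, lowPart_lowPart, min_self, sub_self]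
    rw [this, finrank_top]
  -- Modulo the variables only constants remain. Weights are counted strictly below `k`, so the
  -- series starts at `k = 1` and equals `X / (1 - X)`.
  have hX : lowSeries w (Ideal.span (Set.range (X : σ → MvPolynomial σ K))) *
      (1 - PowerSeries.X) = PowerSeries.X := by
    have h1 : ∀ k, 1 ≤ k →
        Module.finrank K (lowQuotient w (Ideal.span (Set.range (X : σ → MvPolynomial σ K))) k) =
          1 := by
      intro k hk
      classical
      rw [finrank_eq_one_iff']
      have h0 : lowPart w k (1 : MvPolynomial σ K) = 1 := by
        rw [lowPart_eq_self_iff]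
        intro α hα
        rw [coeff_one, if_neg]
        rintro rfl
        rw [map_zero] at hα
        omega
      refine ⟨⟨Ideal.Quotient.mk _ 1, mem_lowQuotient.mpr ⟨1, by rw [h0]⟩⟩, ?_, ?_⟩
      · intro h
        have h2 := Ideal.Quotient.eq_zero_iff_mem.mp (congrArg Subtype.val h)
        rw [← Set.image_univ, mem_ideal_span_X_image] at h2
        obtain ⟨i, -, hi⟩ := h2 0 (by simp)
        simp at hi
      · rintro ⟨x, hx⟩
        obtain ⟨p, rfl⟩ := Ideal.Quotient.mk_surjective x
        refine ⟨constantCoeff p, Subtype.ext ?_⟩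
        change Ideal.Quotient.mk _ (constantCoeff p • (1 : MvPolynomial σ K)) = _
        refine Ideal.Quotient.eq.mpr ?_
        rw [← Set.image_univ, mem_ideal_span_X_image]
        intro α hα
        by_contra hcon
        push Not at hcon
        have hα0 : α = 0 := by
          ext i
          simpa using hcon i (Set.mem_univ i)
        rw [hα0, MvPolynomial.mem_support_iff] at hα
        simp [constantCoeff_eq] at hα
    rw [lowSeries_of_eventually_const h1]
    have h2 : PowerSeries.trunc 1
        (lowSeries w (Ideal.span (Set.range (X : σ → MvPolynomial σ K)))) = 0 := by
      ext k
      rw [PowerSeries.coeff_trunc]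
      split_ifs with hk
      · rw [Nat.lt_one_iff.mp hk, lowSeries, PowerSeries.coeff_mk, finrank_lowQuotient_zero]
        simp
      · simp
    rw [h2]
    simp
  have hQ := lowSeries_of_eventually_const hD
  set D := Module.finrank K (MvPolynomial σ K ⧸ Ideal.span (Set.range g))
  set k₀ := N * ∑ i, w i + 1
  set T := PowerSeries.trunc k₀ (lowSeries w (Ideal.span (Set.range g)))
  -- The series of the polynomial ring itself is eliminated between the identities for `g` and for
  -- the variables. Cancelling `(1 - X)ⁿ` and evaluating at 1 then yields the formula.
  have hpoly : (T * (1 - Polynomial.X) + Polynomial.C (D : ℤ) * Polynomial.X ^ k₀) *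
      ∏ i, (1 - Polynomial.X ^ w i : Polynomial ℤ) =
        Polynomial.X * ∏ i, (1 - Polynomial.X ^ e i : Polynomial ℤ) := by
    apply Polynomial.coe_injective ℤ
    rw [Polynomial.coe_mul, ← hQ, Polynomial.coe_mul, Polynomial.coe_X]
    have hcoe : ∀ d : σ → ℕ, ((∏ i, (1 - Polynomial.X ^ d i : Polynomial ℤ) : Polynomial ℤ) :
        PowerSeries ℤ) = ∏ i, (1 - PowerSeries.X ^ d i) := by
      intro d
      rw [← Polynomial.coeToPowerSeries.ringHom_apply, map_prod]
      simp
    rw [hX1] at hX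
    rw [hcoe, hcoe, hg1]
    linear_combination (∏ i, (1 - PowerSeries.X ^ e i : PowerSeries ℤ)) * hX
  rw [prod_one_sub_X_pow, prod_one_sub_X_pow] at hpoly
  have hne : (1 - Polynomial.X : Polynomial ℤ) ^ (Finset.univ : Finset σ).card ≠ 0 := by
    refine pow_ne_zero _ fun h => ?_
    simpa using congrArg (Polynomial.eval 0) h
  have hpoly' := mul_left_cancel₀ hne ((mul_left_comm _ _ _).symm.trans
    (hpoly.trans (mul_left_comm _ _ _)))
  have heval := congrArg (Polynomial.eval 1) hpoly'
  simp [Polynomial.eval_prod, Polynomial.eval_finsetSum] at heval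
  exact_mod_cast heval

/-- Weighted homogeneous polynomials of positive degrees `e i`, as many as there are variables,
which generate an ideal containing a power of each variable, generate an ideal of codimension
`∏ e i / ∏ w i`. -/
theorem finrank_quotient_mul_prod_of_pow_mem [Fintype σ] (hw : ∀ i, w i ≠ 0)
    {g : σ → MvPolynomial σ K} {e : σ → ℕ} (he : ∀ i, e i ≠ 0)
    (hg : ∀ i, IsWeightedHomogeneous w (g i) (e i)) {N : ℕ}
    (hN : ∀ α : σ →₀ ℕ, N ≤ degree α → monomial α (1 : K) ∈ Ideal.span (Set.range g)) :
    Module.finrank K (MvPolynomial σ K ⧸ Ideal.span (Set.range g)) * ∏ i, w i = ∏ i, e i := by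
  refine finrank_quotient_mul_prod hw hg hN ?_
  let m : Ideal (MvPolynomial σ K) := RingHom.ker (constantCoeff (σ := σ) (R := K))
  have hm : m.IsPrime := RingHom.ker_isPrime _
  have hmX : m = Ideal.span (Set.range X) := by
    ext p
    rw [← Set.image_univ, mem_ideal_span_X_image, RingHom.mem_ker]
    refine ⟨fun h α hα => ?_, fun h => ?_⟩
    · by_contra hcon
      push Not at hcon
      have hα0 : α = 0 := by
        ext i
        simpa using hcon i (Set.mem_univ i)
      rw [hα0, MvPolynomial.mem_support_iff] at hα
      exact hα h
    · by_contra hcon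
      obtain ⟨i, -, hi⟩ := h 0 (MvPolynomial.mem_support_iff.mpr hcon)
      simp at hi
  let A := Localization.AtPrime m
  let ψ := algebraMap (MvPolynomial σ K) A
  have hmap : IsLocalRing.maximalIdeal A = m.map ψ := Localization.AtPrime.map_eq_maximalIdeal.symm
  have hmapX : m.map ψ = (Ideal.span (Set.range X)).map ψ := congrArg (Ideal.map ψ) hmX
  have hregX := isWeaklyRegular_X (K := K) (Finset.univ : Finset σ).toList
    (Finset.nodup_toList _) ∅ (by simp)
  rw [Set.image_empty, Ideal.span_empty] at hregX
  have hregX' : IsWeaklyRegular (A ⧸ (⊥ : Ideal A))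
      (((Finset.univ : Finset σ).toList.map X).map ψ) := by
    rw [isWeaklyRegular_quotient_bot_iff] at hregX ⊢
    exact IsWeaklyRegular.of_isLocalization A m.primeCompl hregX
  refine isWeaklyRegular_of_localization hw m rfl ?_ isHomogeneousIdeal_bot ?_
  · intro p hp
    obtain ⟨i, -, rfl⟩ := List.mem_map.mp hp
    exact ⟨e i, hg i⟩
  · rw [Ideal.map_bot]
    -- The variables serve as the known regular sequence of the same length.
    refine isWeaklyRegular_of_maximalIdeal_le_radical ⊥ _ _ (by simp) ?_ ?_ ?_ ?_ hregX'
    · intro p hp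
      obtain ⟨q, hq, rfl⟩ := List.mem_map.mp hp
      obtain ⟨i, -, rfl⟩ := List.mem_map.mp hq
      rw [hmap]
      exact Ideal.mem_map_of_mem _ (RingHom.mem_ker.mpr (constantCoeff_X K i))
    · intro p hp
      obtain ⟨q, hq, rfl⟩ := List.mem_map.mp hp
      obtain ⟨i, -, rfl⟩ := List.mem_map.mp hq
      rw [hmap]
      refine Ideal.mem_map_of_mem _ (RingHom.mem_ker.mpr ?_)
      rw [constantCoeff_eq]
      exact (hg i).coeff_eq_zero 0 (by rw [map_zero]; exact (he i).symm)
    · rw [bot_sup_eq, ← Ideal.map_ofList, ofList_map_univ, hmap, hmapX]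
      exact Ideal.le_radical
    · rw [bot_sup_eq, ← Ideal.map_ofList, ofList_map_univ, hmap, hmapX, Ideal.map_span,
        Ideal.span_le]
      rintro _ ⟨_, ⟨i, rfl⟩, rfl⟩
      refine ⟨N, ?_⟩
      rw [← map_pow]
      refine Ideal.mem_map_of_mem _ ?_
      rw [X_pow_eq_monomial]
      exact hN _ (by simp)

end HilbertSeries

/-! ### From polynomials to germs -/

section Germs

open Finsupp

variable {n : ℕ}

/-- The algebra map from polynomials to germs. -/
noncomputable def germHom (n : ℕ) : MvPolynomial (Fin n) ℂ →ₐ[ℂ] germRing n :=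
  (MvPolynomial.coeToMvPowerSeries.algHom (R := ℂ) ℂ).codRestrict (germRing n)
    fun f => by
      have h := isConvergent_coe f
      change IsConvergent _
      simpa [MvPolynomial.coeToMvPowerSeries.algHom_apply] using h

theorem germHom_apply (f : MvPolynomial (Fin n) ℂ) : germHom n f = germ f := by
  apply Subtype.ext
  simp [germHom, germ, MvPolynomial.coeToMvPowerSeries.algHom_apply]

/-- The part of `(φ - φ 0) / xᵢ` contributed by the monomials whose first variable is `xᵢ`. -/
noncomputable def hadamardPart (φ : MvPowerSeries (Fin n) ℂ) (i : Fin n) :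
    MvPowerSeries (Fin n) ℂ :=
  fun β => if ∀ j < i, β j = 0 then MvPowerSeries.coeff (β + single i 1) φ else 0

theorem coeff_hadamardPart (φ : MvPowerSeries (Fin n) ℂ) (i : Fin n) (β : Fin n →₀ ℕ) :
    MvPowerSeries.coeff β (hadamardPart φ i) =
      if ∀ j < i, β j = 0 then MvPowerSeries.coeff (β + single i 1) φ else 0 :=
  rfl

theorem isConvergent_hadamardPart {φ : MvPowerSeries (Fin n) ℂ} (hφ : IsConvergent φ)
    (i : Fin n) : IsConvergent (hadamardPart φ i) := by
  obtain ⟨r, hr, h⟩ := hφ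
  refine ⟨r, hr, ?_⟩
  have h1 := (h.comp_injective (add_left_injective (single i 1))).mul_left r⁻¹
  refine Summable.of_nonneg_of_le (fun α => by positivity) (fun α => ?_) h1
  have h2 : degree (α + single i 1) = degree α + 1 := by simp
  simp only [Function.comp_apply, h2, pow_succ]
  have h3 : ‖MvPowerSeries.coeff α (hadamardPart φ i)‖ ≤
      ‖MvPowerSeries.coeff (α + single i 1) φ‖ := by
    rw [coeff_hadamardPart]
    split_ifs <;> simp
  calc _ ≤ ‖MvPowerSeries.coeff (α + single i 1) φ‖ * r ^ degree α := by gcongr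
    _ = _ := by field_simp

theorem eq_sum_hadamardPart (φ : MvPowerSeries (Fin n) ℂ) :
    φ = MvPowerSeries.C (MvPowerSeries.constantCoeff φ) +
      ∑ i, MvPowerSeries.X i * hadamardPart φ i := by
  classical
  ext α
  rw [map_add, map_sum, MvPowerSeries.coeff_C]
  have hterm : ∀ i, MvPowerSeries.coeff α (MvPowerSeries.X i * hadamardPart φ i) =
      if α i ≠ 0 ∧ ∀ j < i, α j = 0 then MvPowerSeries.coeff α φ else 0 := by
    intro i
    by_cases hi : α i = 0
    · rw [if_neg (by simp [hi]), mul_comm, MvPowerSeries.X,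
        MvPowerSeries.coeff_mul_monomial, if_neg (by simp [hi])]
    · have hle : single i 1 ≤ α := by
        rw [single_le_iff]
        omega
      obtain ⟨β, rfl⟩ := exists_add_of_le hle
      rw [MvPowerSeries.X, MvPowerSeries.coeff_add_monomial_mul, one_mul, coeff_hadamardPart,
        add_comm β]
      refine if_congr ?_ rfl rfl
      simp only [hi, ne_eq, not_false_eq_true, true_and]
      refine forall₂_congr fun j hj => ?_
      simp [hj.ne']
  simp_rw [hterm]
  by_cases hα : α = 0
  · subst hα
    simp
  · rw [if_neg hα, zero_add]
    have hne : α.support.Nonempty := by simpa [Finset.nonempty_iff_ne_empty] using hα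
    have hmin := α.support.min'_mem hne
    set i := α.support.min' hne
    rw [Finset.sum_eq_single i, if_pos]
    · refine ⟨by simpa using hmin, fun j hj => ?_⟩
      by_contra hj0
      exact absurd (α.support.min'_le j (by simpa using hj0)) (not_le.mpr hj)
    · intro j _ hji
      refine if_neg fun ⟨h1, h2⟩ => ?_
      rcases lt_or_gt_of_ne hji with h | h
      · exact absurd (α.support.min'_le j (by simpa using h1)) (not_le.mpr h)
      · exact (by simpa using hmin : α i ≠ 0) (h2 i h)
    · simp

/-- Hadamard's lemma: every germ is a constant plus a combination of the coordinates. -/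
theorem exists_eq_const_add_sum (φ : germRing n) :
    ∃ (c : ℂ) (ψ : Fin n → germRing n),
      φ = algebraMap ℂ (germRing n) c + ∑ i, germ (MvPolynomial.X i) * ψ i := by
  refine ⟨MvPowerSeries.constantCoeff φ.1,
    fun i => ⟨hadamardPart φ.1 i, isConvergent_hadamardPart φ.2 i⟩, Subtype.ext ?_⟩
  have h := eq_sum_hadamardPart φ.1
  rw [AddMemClass.coe_add, AddSubmonoidClass.coe_finsetSum]
  simpa [germ, MvPowerSeries.algebraMap_apply] using h

/-- Every germ is a polynomial up to monomials of degree `N`. -/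
theorem exists_germ_sub_mem (J : Ideal (germRing n)) (N : ℕ)
    (hJ : ∀ α : Fin n →₀ ℕ, N ≤ degree α → germ (MvPolynomial.monomial α 1) ∈ J)
    (φ : germRing n) : ∃ p : MvPolynomial (Fin n) ℂ, φ - germ p ∈ J := by
  -- Descent from degree `N`: Hadamard's lemma turns a monomial times a germ into a polynomial plus
  -- monomials of one degree more times germs.
  have key : ∀ k : ℕ, ∀ α : Fin n →₀ ℕ, N ≤ degree α + k → ∀ φ : germRing n,
      ∃ p : MvPolynomial (Fin n) ℂ, germ (MvPolynomial.monomial α 1) * φ - germ p ∈ J := by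
    intro k
    induction k with
    | zero =>
      intro α hα φ
      refine ⟨0, ?_⟩
      rw [← germHom_apply 0, map_zero, sub_zero]
      exact J.mul_mem_right _ (hJ α hα)
    | succ k ih =>
      intro α hα φ
      obtain ⟨c, ψ, rfl⟩ := exists_eq_const_add_sum φ
      choose p hp using fun i => ih (α + single i 1) (by simp; omega) (ψ i)
      refine ⟨MvPolynomial.monomial α 1 * MvPolynomial.C c + ∑ i, p i, ?_⟩
      have h1 := J.sum_mem (t := Finset.univ) fun i _ => hp i
      simp only [← germHom_apply] at h1 ⊢
      convert h1 using 1
      have h2 : germHom n (MvPolynomial.C c) = algebraMap ℂ _ c := by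
        rw [← MvPolynomial.algebraMap_eq, AlgHom.commutes]
      have h3 : ∀ i, germHom n (MvPolynomial.monomial (α + single i 1) 1) =
          germHom n (MvPolynomial.monomial α 1) * germHom n (MvPolynomial.X i) := by
        intro i
        rw [← map_mul, MvPolynomial.X, MvPolynomial.monomial_mul, one_mul]
      rw [map_add, map_mul, h2, map_sum, Finset.sum_sub_distrib, mul_add, Finset.mul_sum]
      simp only [h3, mul_assoc]
      ring
  have h := key N 0 (by simp) φ
  rwa [← germHom_apply (MvPolynomial.monomial 0 1), MvPolynomial.monomial_zero', map_one,
    map_one, one_mul] at h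

theorem mem_of_coeff_eq_zero {I : Ideal (MvPolynomial (Fin n) ℂ)} {N : ℕ}
    (hN : ∀ α : Fin n →₀ ℕ, N ≤ degree α → MvPolynomial.monomial α (1 : ℂ) ∈ I)
    {p : MvPolynomial (Fin n) ℂ} (hp : ∀ α, degree α < N → MvPolynomial.coeff α p = 0) :
    p ∈ I := by
  rw [p.as_sum]
  refine I.sum_mem fun α hα => ?_
  have h2 : N ≤ degree α := by
    by_contra h
    exact MvPolynomial.mem_support_iff.mp hα (hp α (not_le.mp h))
  have h5 := I.mul_mem_left (MvPolynomial.C (MvPolynomial.coeff α p)) (hN α h2)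
  rwa [MvPolynomial.C_mul_monomial, mul_one] at h5

theorem exists_polynomial_coeff_eq (φ : MvPowerSeries (Fin n) ℂ) (N : ℕ) :
    ∃ p : MvPolynomial (Fin n) ℂ,
      ∀ α, degree α < N → MvPolynomial.coeff α p = MvPowerSeries.coeff α φ := by
  have hfin : {α : Fin n →₀ ℕ | degree α < N}.Finite := by
    refine (Set.finite_Iic (equivFunOnFinite.symm fun _ : Fin n => N)).subset fun α hα i => ?_
    exact ((Finsupp.le_degree i α).trans (le_of_lt hα))
  classical
  refine ⟨∑ α ∈ hfin.toFinset, MvPolynomial.monomial α (MvPowerSeries.coeff α φ), fun α hα => ?_⟩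
  rw [MvPolynomial.coeff_sum, Finset.sum_eq_single α]
  · rw [MvPolynomial.coeff_monomial, if_pos rfl]
  · intro β _ hβ
    rw [MvPolynomial.coeff_monomial, if_neg hβ]
  · intro h
    exact absurd (hfin.mem_toFinset.mpr hα) h

theorem coeff_mul_eq_zero {N : ℕ} {φ ψ : MvPowerSeries (Fin n) ℂ}
    (hφ : ∀ α, degree α < N → MvPowerSeries.coeff α φ = 0) (α : Fin n →₀ ℕ) (hα : degree α < N) :
    MvPowerSeries.coeff α (φ * ψ) = 0 := by
  classical
  rw [MvPowerSeries.coeff_mul]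
  refine Finset.sum_eq_zero fun x hx => ?_
  rw [← Finset.HasAntidiagonal.mem_antidiagonal.mp hx, map_add] at hα
  rw [hφ _ (by omega), zero_mul]

/-- If an ideal of polynomials contains all monomials of large degree, then it is the contraction
of the ideal of germs it generates. -/
theorem germ_mem_span_iff {ι : Type*} [Fintype ι] (g : ι → MvPolynomial (Fin n) ℂ) {N : ℕ}
    (hN : ∀ α : Fin n →₀ ℕ, N ≤ degree α →
      MvPolynomial.monomial α (1 : ℂ) ∈ Ideal.span (Set.range g))
    (p : MvPolynomial (Fin n) ℂ) :
    germ p ∈ Ideal.span (Set.range fun i => germ (g i)) ↔ p ∈ Ideal.span (Set.range g) := by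
  constructor
  · intro hp
    obtain ⟨c, hc⟩ := (Ideal.mem_span_range_iff_exists_fun).mp hp
    -- Cutting the coefficients off below degree `N` changes `p` only by terms of degree at least
    -- `N`, all of which lie in the ideal.
    choose q hq using fun i => exists_polynomial_coeff_eq (c i).1 N
    have h1 : p - ∑ i, q i * g i ∈ Ideal.span (Set.range g) := by
      refine mem_of_coeff_eq_zero hN fun α hα => ?_
      have h2 : ((p - ∑ i, q i * g i : MvPolynomial (Fin n) ℂ) : MvPowerSeries (Fin n) ℂ) =
          ∑ i, ((c i).1 - q i) * g i := by
        have h3 := congrArg Subtype.val hc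
        rw [AddSubmonoidClass.coe_finsetSum] at h3
        change ∑ i, (c i).1 * (g i : MvPowerSeries (Fin n) ℂ) = (p : MvPowerSeries (Fin n) ℂ) at h3
        have h4 : ((p - ∑ i, q i * g i : MvPolynomial (Fin n) ℂ) : MvPowerSeries (Fin n) ℂ) =
            p - ∑ i, (q i : MvPowerSeries (Fin n) ℂ) * g i := by
          simp only [← MvPolynomial.coeToMvPowerSeries.ringHom_apply, map_sub, map_sum, map_mul]
        rw [h4, ← h3, ← Finset.sum_sub_distrib]
        exact Finset.sum_congr rfl fun i _ => (sub_mul _ _ _).symm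
      rw [← MvPolynomial.coeff_coe, h2, map_sum]
      refine Finset.sum_eq_zero fun i _ => coeff_mul_eq_zero (N := N) (fun β hβ => ?_) α hα
      rw [map_sub, MvPolynomial.coeff_coe, hq i β hβ, sub_self]
    have h5 : ∑ i, q i * g i ∈ Ideal.span (Set.range g) :=
      Ideal.sum_mem _ fun i _ => Ideal.mul_mem_left _ _ (Ideal.subset_span ⟨i, rfl⟩)
    simpa using Ideal.add_mem _ h1 h5
  · intro hp
    have h := Ideal.mem_map_of_mem (germHom n) hp
    rw [Ideal.map_span, ← Set.range_comp, germHom_apply] at h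
    convert h using 4 with i
    exact (germHom_apply _).symm

theorem finrank_germ_quotient {ι : Type*} [Fintype ι] (g : ι → MvPolynomial (Fin n) ℂ) {N : ℕ}
    (hN : ∀ α : Fin n →₀ ℕ, N ≤ degree α →
      MvPolynomial.monomial α (1 : ℂ) ∈ Ideal.span (Set.range g)) :
    Module.finrank ℂ (germRing n ⧸ Ideal.span (Set.range fun i => germ (g i))) =
      Module.finrank ℂ (MvPolynomial (Fin n) ℂ ⧸ Ideal.span (Set.range g)) := by
  let J : Ideal (germRing n) := Ideal.span (Set.range fun i => germ (g i))
  let φ : MvPolynomial (Fin n) ℂ →ₐ[ℂ] germRing n ⧸ J := (Ideal.Quotient.mkₐ ℂ J).comp (germHom n)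
  have hφ : ∀ p, φ p = Ideal.Quotient.mk J (germ p) := fun p => by
    rw [← germHom_apply]
    rfl
  have hsurj : Function.Surjective φ := by
    intro x
    obtain ⟨ψ, rfl⟩ := Ideal.Quotient.mk_surjective x
    obtain ⟨p, hp⟩ := exists_germ_sub_mem J N
      (fun α hα => (germ_mem_span_iff g hN _).mpr (hN α hα)) ψ
    exact ⟨p, (hφ p).trans (Ideal.Quotient.eq.mpr hp).symm⟩
  have hker : RingHom.ker φ = Ideal.span (Set.range g) := by
    ext p
    rw [RingHom.mem_ker, hφ, Ideal.Quotient.eq_zero_iff_mem]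
    exact germ_mem_span_iff g hN p
  rw [← hker]
  exact (Ideal.quotientKerAlgEquivOfSurjective hsurj).toLinearEquiv.finrank_eq.symm

/-- The monomials of a polynomial whose germ lies in `𝐦 ^ k` have degree at least `k`. -/
theorem le_degree_of_germ_mem_pow {f : MvPolynomial (Fin n) ℂ} {k : ℕ}
    (hf : germ f ∈ maxIdeal n ^ k) {α : Fin n →₀ ℕ} (hα : α ∈ f.support) : k ≤ degree α := by
  have key : ∀ k : ℕ, ∀ φ ∈ maxIdeal n ^ k, (k : ℕ∞) ≤ MvPowerSeries.order φ.1 := by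
    intro k
    induction k with
    | zero => simp
    | succ k ih =>
      intro φ hφ
      rw [pow_succ] at hφ
      refine Submodule.mul_induction_on hφ (fun a ha b hb => ?_) fun a b ha hb => ?_
      · have h1 : (1 : ℕ∞) ≤ MvPowerSeries.order b.1 := by
          rw [MvPowerSeries.one_le_order_iff_constCoeff_eq_zero]
          exact hb
        push_cast
        exact (add_le_add (ih a ha) h1).trans MvPowerSeries.le_order_mul
      · exact (le_min ha hb).trans MvPowerSeries.min_order_le_add
  have h := key k _ hf
  by_contra hlt
  refine MvPolynomial.mem_support_iff.mp hα ?_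
  rw [← MvPolynomial.coeff_coe]
  exact MvPowerSeries.coeff_of_lt_order (lt_of_lt_of_le (by exact_mod_cast not_le.mp hlt) h)

end Germs

/-! ### Weights and Milnor number of a quasihomogeneous singularity -/

section Quasihomogeneous

open MvPolynomial Finsupp

/-- The system `aᵢ yᵢ + y_{κ i} = 0` with all `aᵢ ≥ 2` has only the zero solution. -/
theorem eq_zero_of_mul_add_eq_zero {ι : Type*} [Finite ι] {a : ι → ℕ} {κ : ι → ι}
    (ha : ∀ i, 2 ≤ a i) {y : ι → ℝ} (hy : ∀ i, (a i : ℝ) * y i + y (κ i) = 0) : y = 0 := by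
  funext i
  have : Nonempty ι := ⟨i⟩
  -- At an index where `|y|` is largest, `2 |y j| ≤ |y (κ j)| ≤ |y j|`.
  obtain ⟨j, hj⟩ := Finite.exists_max fun i => |y i|
  have h1 : (a j : ℝ) * |y j| = |y (κ j)| := by
    rw [eq_neg_of_add_eq_zero_right (hy j), abs_neg, abs_mul, Nat.abs_cast]
  have h2 : (2 : ℝ) ≤ a j := by exact_mod_cast ha j
  have h3 := mul_le_mul_of_nonneg_right h2 (abs_nonneg (y j))
  have h4 : |y i| ≤ 0 := by linarith [hj (κ j), hj i]
  simpa using h4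

/-- The system is square with rational coefficients and trivial kernel, so it has a rational
solution, and uniqueness over `ℝ` identifies it with `u`. -/
theorem exists_rat_weights {ι : Type*} [Finite ι] {a : ι → ℕ} {κ : ι → ι}
    (ha : ∀ i, 2 ≤ a i) {u : ι → ℝ} (hu : ∀ i, (a i : ℝ) * u i + u (κ i) = 1) :
    ∃ q : ι → ℚ, ∀ i, (q i : ℝ) = u i := by
  have := Fintype.ofFinite ι
  let L : (ι → ℚ) →ₗ[ℚ] ι → ℚ :=
    { toFun := fun y i => a i * y i + y (κ i)
      map_add' := fun x y => by
        funext i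
        simp only [Pi.add_apply]
        ring
      map_smul' := fun c y => by
        funext i
        simp only [Pi.smul_apply, smul_eq_mul, RingHom.id_apply]
        ring }
  have hinj : Function.Injective L := by
    rw [← LinearMap.ker_eq_bot, LinearMap.ker_eq_bot']
    intro y hy
    have h := eq_zero_of_mul_add_eq_zero (κ := κ) ha (y := fun i => (y i : ℝ)) (fun i => by
      exact_mod_cast congrFun hy i)
    funext i
    have hi : (y i : ℝ) = 0 := congrFun h i
    exact_mod_cast hi
  obtain ⟨q, hq⟩ := LinearMap.injective_iff_surjective.mp hinj 1
  refine ⟨q, fun i => ?_⟩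
  have h := eq_zero_of_mul_add_eq_zero (κ := κ) ha (y := fun i => (q i : ℝ) - u i) (fun i => by
    have h1 : (a i : ℝ) * q i + q (κ i) = 1 := by exact_mod_cast congrFun hq i
    linear_combination h1 - hu i)
  exact sub_eq_zero.mp (congrFun h i)

theorem exists_common_denominator {ι : Type*} [Fintype ι] {q : ι → ℚ} (hq : ∀ i, 0 < q i) :
    ∃ (D : ℕ) (W : ι → ℕ), 0 < D ∧ ∀ i, (W i : ℚ) = q i * D := by
  classical
  refine ⟨∏ i, (q i).den, fun i => (q i).num.toNat * ∏ j ∈ Finset.univ.erase i, (q j).den,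
    Finset.prod_pos fun i _ => (q i).den_pos, fun i => ?_⟩
  have h1 : (((q i).num.toNat : ℕ) : ℚ) = (q i).num := by
    have := Int.toNat_of_nonneg (Rat.num_nonneg.mpr (hq i).le)
    exact_mod_cast this
  rw [← Finset.mul_prod_erase Finset.univ (fun i => (q i).den) (Finset.mem_univ i)]
  push_cast
  rw [h1, ← Rat.mul_den_eq_num (q i)]
  ring

variable {n : ℕ} {f : MvPolynomial (Fin n) ℂ}

/-- If the gradient of `f` vanishes only at the origin, then for every `i` there is a monomial
`xᵢᵃ xₖ` in `f`. -/
theorem HasIsolatedSingularity.exists_monomial (hf : HasIsolatedSingularity f) (i : Fin n) :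
    ∃ (a : ℕ) (k : Fin n), single i a + single k 1 ∈ f.support := by
  classical
  by_contra hcon
  push Not at hcon
  -- At the `i`-th unit vector only pure powers of `xᵢ` in a partial derivative count, and those in
  -- `∂f/∂xₖ` come from monomials `xᵢᵃ xₖ` of `f`.
  have h0 : (Pi.single i 1 : Fin n → ℂ) = 0 := by
    rw [← hf]
    intro k
    rw [eval_eq']
    refine Finset.sum_eq_zero fun β hβ => ?_
    by_cases hβi : ∀ j, j ≠ i → β j = 0
    · have hβ' : β = single i (β i) := by
        ext j
        by_cases hj : j = i
        · subst hj; simp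
        · rw [hβi j hj, single_apply, if_neg (Ne.symm hj)]
      have h1 := hcon (β i) k
      rw [← hβ', MvPolynomial.notMem_support_iff] at h1
      rw [MvPolynomial.mem_support_iff, coeff_pderiv, h1, zero_mul] at hβ
      exact absurd rfl hβ
    · push Not at hβi
      obtain ⟨j, hj, hj0⟩ := hβi
      rw [Finset.prod_eq_zero (Finset.mem_univ j), mul_zero]
      rw [Pi.single_eq_of_ne hj, zero_pow hj0]
  simpa using congrFun h0 i

/-- If the gradient of `f` vanishes only at the origin, then the ideal generated by the partial
derivatives contains all monomials of large degree. -/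
theorem HasIsolatedSingularity.exists_monomial_mem (hf : HasIsolatedSingularity f) :
    ∃ N : ℕ, ∀ α : Fin n →₀ ℕ, N ≤ degree α →
      monomial α (1 : ℂ) ∈ Ideal.span (Set.range fun i => pderiv i f) := by
  have hX : ∀ i : Fin n, ∃ M : ℕ,
      (X i : MvPolynomial (Fin n) ℂ) ^ M ∈ Ideal.span (Set.range fun i => pderiv i f) := by
    intro i
    have h : (X i : MvPolynomial (Fin n) ℂ) ∈
        (Ideal.span (Set.range fun i => pderiv i f)).radical := by
      -- Nullstellensatz: the common zeros of the partial derivatives reduce to the origin, where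
      -- `xᵢ` vanishes.
      rw [← vanishingIdeal_zeroLocus_eq_radical (K := ℂ)]
      intro x hx
      have hx0 : x = 0 := (hf x).mp fun k => by
        have := hx _ (Ideal.subset_span ⟨k, rfl⟩)
        rwa [aeval_eq_eval] at this
      simp [hx0]
    exact h
  choose M hM using hX
  refine ⟨∑ i, M i + 1, fun α hα => ?_⟩
  obtain ⟨i, hi⟩ : ∃ i, M i ≤ α i := by
    by_contra hcon
    push Not at hcon
    have := Finset.sum_le_sum fun i (_ : i ∈ Finset.univ) => (hcon i).le
    rw [degree_eq_sum] at hα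
    omega
  have h1 : monomial α (1 : ℂ) = monomial (α - single i (M i)) 1 * X i ^ M i := by
    rw [X_pow_eq_monomial, monomial_mul, one_mul,
      tsub_add_cancel_of_le (single_le_iff.mpr hi)]
  rw [h1]
  exact Ideal.mul_mem_left _ _ (hM i)

/-- The Milnor number of a weighted homogeneous polynomial with an isolated singularity. -/
theorem HasIsolatedSingularity.milnorNumber_mul_prod (hf : HasIsolatedSingularity f)
    {W : Fin n → ℕ} {D : ℕ} (hW : ∀ i, W i ≠ 0) (hWD : ∀ i, W i < D)
    (hfW : IsWeightedHomogeneous W f D) : milnorNumber f * ∏ i, W i = ∏ i, (D - W i) := by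
  obtain ⟨N, hN⟩ := hf.exists_monomial_mem
  rw [milnorNumber, jacobianIdeal, finrank_germ_quotient _ hN]
  exact finrank_quotient_mul_prod_of_pow_mem hW (fun i => (Nat.sub_pos_of_lt (hWD i)).ne')
    (fun i => hfW.pderiv (Nat.sub_add_cancel (hWD i).le)) hN

/-- A quasihomogeneous polynomial in `𝐦³` with an isolated singularity has rational weights, and
these satisfy equations `aᵢ wᵢ + w_{κ i} = 1` and determine the Milnor number. -/
theorem exists_weights (hq : IsQuasihomogeneous f) (hm : germ f ∈ maxIdeal n ^ 3)
    (hf : HasIsolatedSingularity f) :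
    ∃ (w : Fin n → ℚ) (a : Fin n → ℕ) (κ : Fin n → Fin n), (∀ i, 0 < w i) ∧ (∀ i, 2 ≤ a i) ∧
      (∀ i, (a i : ℚ) * w i = 1 - w (κ i)) ∧ ∏ i, (1 - w i) / w i = milnorNumber f := by
  classical
  obtain ⟨v, d, hv, hd, hvd⟩ := hq
  choose a κ haκ using hf.exists_monomial
  have ha : ∀ i, 2 ≤ a i := by
    intro i
    have h := le_degree_of_germ_mem_pow hm (haκ i)
    simp only [map_add, degree_single] at h
    omega
  have hsum : ∀ α ∈ f.support, ∑ i, (α i : ℝ) * (v i / d) = 1 := by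
    intro α hα
    rw [← div_self hd.ne', ← hvd α hα, Finset.sum_div]
    simp only [mul_div_assoc]
  have hu : ∀ i, (a i : ℝ) * (v i / d) + v (κ i) / d = 1 := by
    intro i
    have h := hsum _ (haκ i)
    simpa [add_mul, Finset.sum_add_distrib, single_apply, ite_mul] using h
  obtain ⟨q, hqu⟩ := exists_rat_weights ha (u := fun i => v i / d) hu
  have hq0 : ∀ i, 0 < q i := fun i => by
    have : (0 : ℝ) < q i := by
      rw [hqu i]
      exact div_pos (hv i) hd
    exact_mod_cast this
  have hqa : ∀ i, (a i : ℚ) * q i = 1 - q (κ i) := by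
    intro i
    have h := hu i
    simp only [← hqu] at h
    rw [eq_sub_iff_add_eq]
    exact_mod_cast h
  refine ⟨q, a, κ, hq0, ha, hqa, ?_⟩
  obtain ⟨D, W, hD, hW⟩ := exists_common_denominator hq0
  have hDQ : (0 : ℚ) < D := by exact_mod_cast hD
  have hW0 : ∀ i, W i ≠ 0 := fun i h => by
    have h1 := hW i
    rw [h, Nat.cast_zero] at h1
    exact (mul_pos (hq0 i) hDQ).ne h1
  have hWD : ∀ i, W i < D := fun i => by
    have h1 := weight_lt_half hq0 ha hqa i
    have h2 : (W i : ℚ) < D := by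
      rw [hW i]
      exact mul_lt_of_lt_one_left hDQ (by linarith)
    exact_mod_cast h2
  have hfW : IsWeightedHomogeneous W f D := by
    intro α hα
    have h1 : ∑ i, (α i : ℚ) * q i = 1 := by
      have h := hsum α (MvPolynomial.mem_support_iff.mpr hα)
      simp only [← hqu] at h
      exact_mod_cast h
    have h2 : ((weight W α : ℕ) : ℚ) = D := by
      rw [weight_apply, Finsupp.sum_fintype _ _ (by simp)]
      push_cast [smul_eq_mul]
      simp only [hW, ← mul_assoc]
      rw [← Finset.sum_mul, h1, one_mul]
    exact_mod_cast h2
  have h := hf.milnorNumber_mul_prod hW0 hWD hfW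
  have h' : (milnorNumber f : ℚ) * ∏ i, (W i : ℚ) = ∏ i, ((D : ℚ) - W i) := by
    have h1 := congrArg (Nat.cast (R := ℚ)) h
    push_cast at h1
    rw [h1]
    exact Finset.prod_congr rfl fun i _ => Nat.cast_sub (hWD i).le
  have hne : ∏ i, (W i : ℚ) ≠ 0 :=
    Finset.prod_ne_zero_iff.mpr fun i _ => by exact_mod_cast hW0 i
  rw [← mul_left_inj' hne, h', ← Finset.prod_mul_distrib]
  refine Finset.prod_congr rfl fun i _ => ?_
  have := (hq0 i).ne'
  rw [hW i]
  field_simp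

end Quasihomogeneous

end QHSing

theorem corollary6p3 (n : ℕ) (hn : 3 ≤ n) :
    {μ : ℕ | ∃ p : ℕ, p.Prime ∧ μ.Prime ∧ (μ : ℤ) = 2 * (p : ℤ) + (-1) ^ n ∧ 2 ^ n < μ} ⊆
      {μ : ℕ | QHSing.IsGap n μ} := by
  rintro μ ⟨p, hp, hμ, hμp, hlt⟩
  refine ⟨hlt, ?_⟩
  rintro ⟨f, hq, hm, hf, rfl⟩
  obtain ⟨w, a, κ, hw, ha, h, hprod⟩ := QHSing.exists_weights hq hm hf
  exact QHSing.prime_ne_of_weights hw ha h (by simpa using hn) hμ hp hprod (by simpa using hμp)
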